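/- Let $D_1,D_2,\dots$ be i.i.d. random elements of a measurable space and $D=(D_1,\dots,D_n)$. Let $\hat\theta_g$, $g=0,\dots,G$, be estimators, i.e. measurable real-valued functions of a data set of arbitrary size, and let $\theta_g\in\mathbb R$. Assume: 1. For each $g$, $\hat\theta_g(D)-\theta_g=\frac1n\sum_{i=1}^n\psi_g(D_i)+e_g(n)$, where $\psi_g(D_1)$ is centered with finite nonzero second moment and $\mathbb E[e_g(n)^2]=o(1/n)$; moreover $|\mathrm{Cor}(\psi_g(D_1),\psi_0(D_1))|\neq 1$ for $g\neq 0$. 2. For each $g$, the variance estimators $\widehat{\mathrm{Var}}(\hat\theta_g-\hat\theta_0)$ and $\widehat{\mathrm{Var}}(\hat\theta_g)$ satisfy $n\widehat{\mathrm{Var}}(\hat\theta_g-\hat\theta_0)-\lim_n n\mathrm{Var}(\hat\theta_g-\hat\theta_0)=o_P(1)$ and $n\widehat{\mathrm{Var}}(\hat\theta_g)-\lim_n n\mathrm{Var}(\hat\theta_g)=o_P(1)$. Fix $K\ge 2$. For each $n$ the data are randomly split, independently of their values, into $K$ disjoint folds $D^{0,1},\dots,D^{0,K}$ of roughly equal size,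 i.e. $|D^{0,k}|/n\to 1/K$ in probability; put $D^{1,k}=D\setminus D^{0,k}$. Define $$R(g)=\mathbb E[(\hat\theta_g(D)-\theta_0)^2],\qquad \hat R(g)=(\hat\theta_g(D)-\hat\theta_0(D))^2-\widehat{\mathrm{Var}}(\hat\theta_g-\hat\theta_0)+\widehat{\mathrm{Var}}(\hat\theta_g),$$ $$\tilde R(g)=\frac1K\sum_{k=1}^K\big(\hat\theta_g(D^{1,k})-\hat\theta_0(D^{0,k})\big)^2 .$$ The asymptotic variance of a sequence of random variables that converges in distribution to a square-integrable law is the variance of that law. Then for every $g\in\{0,\dots,G\}$: (i) If $\theta_g=\theta_0$, both $n(\hat R(g)-R(g))$ and $n(\tilde R(g)-R(g))$ converge in distribution to square-integrable laws as $n\to\infty$, and the asymptotic variance of $n(\hat R(g)-R(g))$ is strictly lower than that of $n(\tilde R(g)-R(g))$. (ii) If $\theta_g\neq\theta_0$, both $\sqrt n(\hat R(g)-R(g))$ and $\sqrt n(\tilde R(g)-R(g))$ converge in distribution to square-integrable laws as $n\to\infty$, and their asymptotic variances are equal. -/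

import Mathlib

open MeasureTheory ProbabilityTheory Filter Topology Asymptotics

noncomputable section

namespace ModelSelection

variable {Ω 𝒳 : Type*}

/-- An estimator: a real-valued function of data sets of every size. -/
abbrev Estimator (𝒳 : Type*) := (m : ℕ) → (Fin m → 𝒳) → ℝ

/-- The estimator computed on the whole data set of the first `n` observations. -/
def onFull (D : ℕ → Ω → 𝒳) (T : Estimator 𝒳) (n : ℕ) (ω : Ω) : ℝ :=
  T n (fun i => D i ω)

/-- The estimator computed on the observations with index in `s`, listed in increasing order
of their index. -/
def onSubset (D : ℕ → Ω → 𝒳) (T : Estimator 𝒳) {n : ℕ} (s : Finset (Fin n)) (ω : Ω) : ℝ :=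
  T s.card (fun j => D (s.orderEmbOfFin rfl j) ω)

/-- The observations are independent with a common distribution. -/
structure IsIID [MeasurableSpace Ω] [MeasurableSpace 𝒳] (P : Measure Ω) (D : ℕ → Ω → 𝒳) :
    Prop where
  measurable : ∀ i, Measurable (D i)
  indep : iIndepFun D P
  ident : ∀ i, IdentDistrib (D i) (D 0) P P

/-- The remainder `e(n)` in `T - θ = n⁻¹ ∑ ψ(D_i) + e(n)`. -/
def remainder (D : ℕ → Ω → 𝒳) (T : Estimator 𝒳) (θ : ℝ) (ψ : 𝒳 → ℝ) (n : ℕ) (ω : Ω) : ℝ :=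
  onFull D T n ω - θ - (1 / (n : ℝ)) * ∑ i ∈ Finset.range n, ψ (D i ω)

/-- Asymptotic linearity with influence function `ψ`, in mean square: `ψ(D_1)` is centered with
finite nonzero second moment, and `E[e(n)²] = o(1/n)`. -/
structure IsAsympLinear [MeasurableSpace Ω] [MeasurableSpace 𝒳] (P : Measure Ω)
    (D : ℕ → Ω → 𝒳) (T : Estimator 𝒳) (θ : ℝ) (ψ : 𝒳 → ℝ) : Prop where
  measurable_estimator : ∀ m, Measurable (T m)
  measurable_influence : Measurable ψ
  memLp : MemLp (fun ω => ψ (D 0 ω)) 2 P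
  centered : ∫ ω, ψ (D 0 ω) ∂P = 0
  nonzero : ∫ ω, ψ (D 0 ω) ^ 2 ∂P ≠ 0
  remainder_integrable : ∀ᶠ n in atTop, Integrable (fun ω => remainder D T θ ψ n ω ^ 2) P
  remainder_small :
    (fun n : ℕ => ∫ ω, remainder D T θ ψ n ω ^ 2 ∂P) =o[atTop] (fun n : ℕ => 1 / (n : ℝ))

/-- The correlation of two random variables. -/
def correlation [MeasurableSpace Ω] (P : Measure Ω) (X Y : Ω → ℝ) : ℝ :=
  cov[X, Y; P] / (√(Var[X; P]) * √(Var[Y; P]))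

/-- `V n` consistently estimates the variance of `X n`: the limit of `n * Var(X n)` exists and
`n * V n` minus this limit is `o_P(1)`. -/
def IsConsistentVariance [MeasurableSpace Ω] (P : Measure Ω) (V X : ℕ → Ω → ℝ) : Prop :=
  (∀ n, AEMeasurable (V n) P) ∧
  ∃ v : ℝ, Tendsto (fun n : ℕ => (n : ℝ) * Var[X n; P]) atTop (𝓝 v) ∧
    TendstoInMeasure P (fun (n : ℕ) ω => (n : ℝ) * V n ω - v) atTop (fun _ => 0)

/-- The `k`-th validation fold of the split `a` of `n` observations into `K` folds. -/
def fold {K n : ℕ} (a : Fin n → Fin K) (k : Fin K) : Finset (Fin n) :=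
  Finset.univ.filter (fun i => a i = k)

/-- A random split of the data into `K` disjoint folds of roughly equal size, drawn independently
of the data: `A n ω i` is the fold of the `i`-th among `n` observations. -/
structure IsRandomSplit [MeasurableSpace Ω] [MeasurableSpace 𝒳] (P : Measure Ω)
    (D : ℕ → Ω → 𝒳) {K : ℕ} (A : (n : ℕ) → Ω → Fin n → Fin K) : Prop where
  measurable : ∀ n, Measurable (A n)
  indep : ∀ n, IndepFun (A n) (fun ω i => D i ω) P
  equal_size : ∀ k, TendstoInMeasure P
    (fun n ω => ((fold (A n ω) k).card : ℝ) / (n : ℝ)) atTop (fun _ => 1 / (K : ℝ))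

/-- The mean-squared error `E[(T - θ₀)²]` of an estimator on `n` observations. -/
def mse [MeasurableSpace Ω] (P : Measure Ω) (D : ℕ → Ω → 𝒳) (T : Estimator 𝒳) (θ₀ : ℝ) (n : ℕ) :
    ℝ :=
  ∫ ω, (onFull D T n ω - θ₀) ^ 2 ∂P

/-- The targeted criterion `(T - T₀)² - V̂ar(T - T₀) + V̂ar(T)`. -/
def riskHat (D : ℕ → Ω → 𝒳) (T T₀ : Estimator 𝒳) (Vdiff V : ℕ → Ω → ℝ) (n : ℕ) (ω : Ω) : ℝ :=
  (onFull D T n ω - onFull D T₀ n ω) ^ 2 - Vdiff n ω + V n ω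

/-- The cross-validation criterion: `T` is computed on the complement of each fold and `T₀` on
the fold itself. -/
def riskCV (D : ℕ → Ω → 𝒳) (T T₀ : Estimator 𝒳) {K : ℕ} (A : (n : ℕ) → Ω → Fin n → Fin K)
    (n : ℕ) (ω : Ω) : ℝ :=
  (1 / (K : ℝ)) * ∑ k : Fin K,
    (onSubset D T (fold (A n ω) k)ᶜ ω - onSubset D T₀ (fold (A n ω) k) ω) ^ 2

/-- `X n` has asymptotic variance `v`: it converges in distribution to a square-integrable law
with variance `v`. -/
def HasAsympVariance [MeasurableSpace Ω] (P : Measure Ω) [IsProbabilityMeasure P]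
    (X : ℕ → Ω → ℝ) (v : ℝ) : Prop :=
  ∃ ν : ProbabilityMeasure ℝ, MemLp (fun x : ℝ => x) 2 (ν : Measure ℝ) ∧
    Var[fun x : ℝ => x; (ν : Measure ℝ)] = v ∧
    TendstoInDistribution X atTop (fun x : ℝ => x) (fun _ => P) (ν : Measure ℝ)

end ModelSelection

end

/-! ### Convergence in measure to constants. -/

section ConvergenceInMeasure

variable {α : Type*} {mα : MeasurableSpace α} {μ : Measure α}

/-! Both criteria are, to leading order, functions of one Gaussian vector `x`: the limit of the sums
of `ψ g` (coordinate 0) and `ψ 0` (coordinate 1) over each fold, scaled by `n^{-1/2}`. Its fold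
blocks are independent with a common covariance. This is `tendstoInDistribution_foldScore`: freeze
the split, which is independent of the data, expand the product of characteristic functions, then
let the fold fractions tend to `1/K`. The remainders on random subsets are negligible
(`tendstoInMeasure_subsetRemainder`), because a frozen subset has the same law as an initial segment
of equal size. By Slutsky, with `δ = θ g - θ 0`, the scaled differences of estimators centered at
`δ` converge to the linear forms `fullForm x` (whole sample) and `cvForm x k` (fold `k`).

The algebraic link is that `fullForm` is the average of the `cvForm · k` (`sum_cvForm`). For `δ ≠ 0`
squaring is linear to first order, so both criteria have the limit `2 δ fullForm`. For `δ = 0` the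
limits are, up to additive constants, `fullForm ^ 2` and the average of `cvForm · k ^ 2`. By
`sum_sq_cvForm` the latter is `fullForm ^ 2` plus the mean squared deviation of the `cvForm · k`
from their average. Those deviations are uncorrelated with `fullForm`, hence independent of it by
joint Gaussianity, so the variances add (`variance_fullForm_sq_lt`). The extra variance vanishes
only if `ψ g / (K - 1) + ψ 0` is almost surely zero, which the correlation condition excludes for `g
≠ 0` and the nonzero second moment excludes for `g = 0`. -/

theorem MeasureTheory.TendstoInMeasure.pi {ι κ E : Type*} [Fintype κ] [PseudoEMetricSpace E]
    {l : Filter ι} {f : ι → α → κ → E} {g : α → κ → E}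
    (h : ∀ k, TendstoInMeasure μ (fun i ω => f i ω k) l (fun ω => g ω k)) :
    TendstoInMeasure μ f l g := by
  intro ε hε
  have hsum : Tendsto (fun i => ∑ k, μ {x | ε ≤ edist (f i x k) (g x k)}) l (𝓝 0) := by
    simpa using tendsto_finsetSum Finset.univ (fun k _ => h k ε hε)
  refine tendsto_of_tendsto_of_tendsto_of_le_of_le tendsto_const_nhds hsum
    (fun _ => zero_le) fun i => ?_
  refine (measure_mono ?_).trans (measure_iUnion_fintype_le μ _)
  intro x hx
  simp only [Set.mem_ofPred_eq] at hx
  by_contra hcon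
  simp only [Set.mem_iUnion, Set.mem_ofPred_eq, not_exists, not_le] at hcon
  refine absurd hx (not_le.2 ?_)
  rw [edist_pi_def, Finset.sup_lt_iff hε]
  exact fun k _ => hcon k

/-- Since the limit is a constant, continuity at that single point suffices; this allows inverting
the fold fractions, whose limits are nonzero. -/
theorem MeasureTheory.TendstoInMeasure.comp_continuousAt {ι E F : Type*} [PseudoEMetricSpace E]
    [PseudoEMetricSpace F] {l : Filter ι} {f : ι → α → E} {c : E}
    (h : TendstoInMeasure μ f l (fun _ => c)) {φ : E → F} (hφ : ContinuousAt φ c) :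
    TendstoInMeasure μ (fun i ω => φ (f i ω)) l (fun _ => φ c) := by
  intro ε hε
  obtain ⟨δ, hδ, H⟩ := EMetric.continuousAt_iff.1 hφ ε hε
  refine tendsto_of_tendsto_of_tendsto_of_le_of_le tendsto_const_nhds (h δ hδ)
    (fun _ => zero_le) fun i => measure_mono fun x hx => ?_
  by_contra hcon
  exact absurd hx (not_le.2 (H (not_le.1 hcon)))

theorem tendstoInMeasure_const_of_tendsto {ι E : Type*} [PseudoEMetricSpace E]
    {l : Filter ι} {u : ι → E} {c : E} (h : Tendsto u l (𝓝 c)) :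
    TendstoInMeasure μ (fun i _ => u i) l (fun _ => c) := by
  intro ε hε
  refine tendsto_const_nhds.congr' ?_
  filter_upwards [EMetric.tendsto_nhds.1 h ε hε] with i hi
  simp [not_le.2 hi]

theorem MeasureTheory.TendstoInMeasure.add_const_lim {ι : Type*} {l : Filter ι}
    {f g : ι → α → ℝ} {a b : ℝ} (hf : TendstoInMeasure μ f l (fun _ => a))
    (hg : TendstoInMeasure μ g l (fun _ => b)) :
    TendstoInMeasure μ (fun i ω => f i ω + g i ω) l (fun _ => a + b) := by
  have h : TendstoInMeasure μ (fun i ω => ![f i ω, g i ω]) l (fun _ => ![a, b]) :=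
    TendstoInMeasure.pi fun k => by fin_cases k <;> simpa
  simpa using h.comp_continuousAt (φ := fun v : Fin 2 → ℝ => v 0 + v 1) (by fun_prop)

theorem MeasureTheory.TendstoInMeasure.mul_const_lim {ι : Type*} {l : Filter ι}
    {f g : ι → α → ℝ} {a b : ℝ} (hf : TendstoInMeasure μ f l (fun _ => a))
    (hg : TendstoInMeasure μ g l (fun _ => b)) :
    TendstoInMeasure μ (fun i ω => f i ω * g i ω) l (fun _ => a * b) := by
  have h : TendstoInMeasure μ (fun i ω => ![f i ω, g i ω]) l (fun _ => ![a, b]) :=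
    TendstoInMeasure.pi fun k => by fin_cases k <;> simpa
  simpa using h.comp_continuousAt (φ := fun v : Fin 2 → ℝ => v 0 * v 1) (by fun_prop)

/-- Chebyshev's inequality for the second moment about zero. -/
theorem measure_le_abs_le_integral_sq {X : α → ℝ} (hX : Integrable (fun ω => X ω ^ 2) μ)
    {c : ℝ} (hc : 0 < c) :
    μ {ω | c ≤ |X ω|} ≤ ENNReal.ofReal ((∫ ω, X ω ^ 2 ∂μ) / c ^ 2) := by
  have h1 : {ω | c ≤ |X ω|} = {ω | c ^ 2 ≤ X ω ^ 2} := by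
    ext ω
    simp only [Set.mem_ofPred_eq]
    rw [← sq_abs (X ω)]
    exact (pow_le_pow_iff_left₀ hc.le (abs_nonneg _) two_ne_zero).symm
  have hm := mul_meas_ge_le_integral_of_nonneg (μ := μ)
    (Eventually.of_forall fun ω => sq_nonneg (X ω)) hX (c ^ 2)
  have hfin : μ {ω | c ^ 2 ≤ X ω ^ 2} ≠ ⊤ := (hX.measure_ge_lt_top (by positivity)).ne
  rw [h1, ← ENNReal.ofReal_toReal hfin]
  refine ENNReal.ofReal_le_ofReal ?_
  rw [le_div_iff₀ (by positivity), mul_comm]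
  exact hm

end ConvergenceInMeasure

/-! ### Freezing one of two independent variables. -/

section Independence

variable {Ω : Type*} [MeasurableSpace Ω] {P : Measure Ω} [IsProbabilityMeasure P]

theorem measurable_uncurry_of_countable {α β γ : Type*} [MeasurableSpace α] [MeasurableSpace β]
    [MeasurableSpace γ] [Countable α] [MeasurableSingletonClass α] {f : α → β → γ}
    (hf : ∀ a, Measurable (f a)) : Measurable (Function.uncurry f) :=
  measurable_from_prod_countable_right hf

/-- Fubini on the product law of the pair. It serves to treat the random split as fixed while
integrating over the data. -/
theorem ProbabilityTheory.IndepFun.integral_eq_integral_integral {α β : Type*} [MeasurableSpace α]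
    [MeasurableSpace β] {A : Ω → α} {X : Ω → β} (hA : Measurable A) (hX : Measurable X)
    (h : IndepFun A X P) {f : α → β → ℂ} (hf : Measurable (Function.uncurry f))
    {C : ℝ} (hC : ∀ a x, ‖f a x‖ ≤ C) :
    ∫ ω, f (A ω) (X ω) ∂P = ∫ ω, ∫ ω', f (A ω) (X ω') ∂P ∂P := by
  have hPA := Measure.isProbabilityMeasure_map (μ := P) hA.aemeasurable
  have hPX := Measure.isProbabilityMeasure_map (μ := P) hX.aemeasurable
  have hprod := (indepFun_iff_map_prod_eq_prod_map_map hA.aemeasurable hX.aemeasurable).1 h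
  have h1 : ∫ ω, f (A ω) (X ω) ∂P
      = ∫ p, Function.uncurry f p ∂(P.map fun ω => (A ω, X ω)) := by
    rw [integral_map (hA.prodMk hX).aemeasurable hf.aestronglyMeasurable]
    rfl
  have hint : Integrable (Function.uncurry f) ((P.map A).prod (P.map X)) :=
    Integrable.of_bound hf.aestronglyMeasurable C (Eventually.of_forall fun p => hC _ _)
  rw [h1, hprod, integral_prod _ hint, integral_map hA.aemeasurable
    hint.aestronglyMeasurable.integral_prod_right']
  refine integral_congr_ae (Eventually.of_forall fun ω => ?_)
  simp only [Function.uncurry_apply_pair]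
  rw [integral_map hX.aemeasurable]
  exact (hf.comp measurable_prodMk_left).aestronglyMeasurable

theorem ProbabilityTheory.IndepFun.measure_eq_lintegral {α β : Type*} [MeasurableSpace α]
    [MeasurableSpace β] {A : Ω → α} {X : Ω → β} (hA : Measurable A) (hX : Measurable X)
    (h : IndepFun A X P) {s : Set (α × β)} (hs : MeasurableSet s) :
    P {ω | (A ω, X ω) ∈ s} = ∫⁻ ω, P {ω' | (A ω, X ω') ∈ s} ∂P := by
  have hPA := Measure.isProbabilityMeasure_map (μ := P) hA.aemeasurable
  have hPX := Measure.isProbabilityMeasure_map (μ := P) hX.aemeasurable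
  have hprod := (indepFun_iff_map_prod_eq_prod_map_map hA.aemeasurable hX.aemeasurable).1 h
  have h1 : P {ω | (A ω, X ω) ∈ s} = (P.map fun ω => (A ω, X ω)) s := by
    rw [Measure.map_apply (hA.prodMk hX) hs]; rfl
  rw [h1, hprod, Measure.prod_apply hs, lintegral_map (measurable_measure_prodMk_left hs) hA]
  refine lintegral_congr fun ω => ?_
  rw [Measure.map_apply hX (measurable_prodMk_left hs)]
  rfl

end Independence

/-! ### Characteristic functions near zero. -/

section CharacteristicFunction

open Complex

/-- Replace the factors one at a time; all the others lie in the unit disc and do not enlarge the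
error. -/
theorem norm_prod_sub_prod_le_sum {ι : Type*} (s : Finset ι) (z w : ι → ℂ)
    (hz : ∀ i, ‖z i‖ ≤ 1) (hw : ∀ i, ‖w i‖ ≤ 1) :
    ‖∏ i ∈ s, z i - ∏ i ∈ s, w i‖ ≤ ∑ i ∈ s, ‖z i - w i‖ := by
  classical
  induction s using Finset.induction_on with
  | empty => simp
  | insert a s ha ih =>
    rw [Finset.prod_insert ha, Finset.prod_insert ha, Finset.sum_insert ha]
    have hs : ‖∏ i ∈ s, z i‖ ≤ 1 := by
      rw [norm_prod]
      exact Finset.prod_le_one (fun i _ => norm_nonneg _) (fun i _ => hz i)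
    calc ‖z a * ∏ i ∈ s, z i - w a * ∏ i ∈ s, w i‖
        = ‖(z a - w a) * ∏ i ∈ s, z i + w a * (∏ i ∈ s, z i - ∏ i ∈ s, w i)‖ := by ring_nf
      _ ≤ ‖z a - w a‖ * ‖∏ i ∈ s, z i‖ + ‖w a‖ * ‖∏ i ∈ s, z i - ∏ i ∈ s, w i‖ := by
          refine (norm_add_le _ _).trans ?_
          rw [norm_mul, norm_mul]
      _ ≤ ‖z a - w a‖ * 1 + 1 * ∑ i ∈ s, ‖z i - w i‖ := by
          gcongr
          exact hw a
      _ = _ := by ring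

variable {Ω : Type*} [MeasurableSpace Ω] {P : Measure Ω} [IsProbabilityMeasure P]

theorem isLittleO_charFun_sub_taylor_two {X : Ω → ℝ} (hX : MemLp X 2 P) (h0 : ∫ ω, X ω ∂P = 0) :
    (fun t : ℝ => charFun (P.map X) t - (1 - ((∫ ω, X ω ^ 2 ∂P : ℝ) : ℂ) * t ^ 2 / 2))
      =o[𝓝 0] fun t => t ^ 2 := by
  have hXm := hX.aestronglyMeasurable.aemeasurable
  have := Measure.isProbabilityMeasure_map (μ := P) hXm
  have hid : MemLp id 2 (P.map X) := by
    rw [memLp_map_measure_iff aestronglyMeasurable_id hXm]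
    exact hX
  have htay := taylor_isLittleO_univ (n := 2) (x₀ := (0 : ℝ)) (contDiff_charFun (μ := P.map X) hid)
  refine (htay.congr (fun t => ?_) fun t => by simp)
  rw [taylorWithinEval_charFun_two_zero hXm hid]
  simp [h0]

/-- Second-order Taylor expansion leaves an error `o(1/n)`, and `exp(-v/(2n))` differs from `1 -
v/(2n)` by `O(1/n²)`. Comparing with an exponential turns a product over folds into an explicit
function of the fold sizes. -/
theorem tendsto_mul_charFun_sub_exp {X : Ω → ℝ} (hX : MemLp X 2 P) (h0 : ∫ ω, X ω ∂P = 0) :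
    Tendsto (fun n : ℕ => (n : ℝ) * ‖charFun (P.map X) (√(n : ℝ))⁻¹
      - exp (-(((∫ ω, X ω ^ 2 ∂P) / 2 / n : ℝ) : ℂ))‖) atTop (𝓝 0) := by
  set v := ∫ ω, X ω ^ 2 ∂P
  have hinv : Tendsto (fun n : ℕ => (√(n : ℝ))⁻¹) atTop (𝓝 0) :=
    tendsto_inv_atTop_zero.comp (Real.tendsto_sqrt_atTop.comp tendsto_natCast_atTop_atTop)
  have h1 := (isLittleO_charFun_sub_taylor_two hX h0).comp_tendsto hinv
  have h2 : Tendsto (fun n : ℕ => (n : ℝ) * ‖charFun (P.map X) (√(n : ℝ))⁻¹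
      - (1 - (v : ℂ) * (((√(n : ℝ))⁻¹ : ℝ) : ℂ) ^ 2 / 2)‖) atTop (𝓝 0) := by
    have h3 := h1.norm_left.tendsto_div_nhds_zero
    refine h3.congr' ?_
    filter_upwards [eventually_gt_atTop 0] with n hn
    have : ((√(n : ℝ))⁻¹) ^ 2 = (n : ℝ)⁻¹ := by
      rw [inv_pow, Real.sq_sqrt (Nat.cast_nonneg n)]
    simp only [Function.comp_apply, this, v]
    rw [div_inv_eq_mul, mul_comm]
  have h4 : Tendsto (fun n : ℕ => (n : ℝ) * (v / 2 / n) ^ 2) atTop (𝓝 0) := by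
    have : Tendsto (fun n : ℕ => (v / 2) ^ 2 * (n : ℝ)⁻¹) atTop (𝓝 ((v / 2) ^ 2 * 0)) :=
      tendsto_const_nhds.mul (tendsto_inv_atTop_zero.comp tendsto_natCast_atTop_atTop)
    rw [mul_zero] at this
    refine this.congr' ?_
    filter_upwards [eventually_gt_atTop 0] with n hn
    have : (n : ℝ) ≠ 0 := by positivity
    field_simp
  have hsmall : ∀ᶠ n : ℕ in atTop, |v / 2 / n| ≤ 1 := by
    have : Tendsto (fun n : ℕ => |v / 2 / (n : ℝ)|) atTop (𝓝 |0|) :=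
      (tendsto_const_nhds.div_atTop tendsto_natCast_atTop_atTop).abs
    rw [abs_zero] at this
    exact this.eventually_le_const one_pos
  have h5 := h2.add h4
  rw [add_zero] at h5
  refine squeeze_zero' (Eventually.of_forall fun n => by positivity) ?_ h5
  filter_upwards [hsmall, eventually_gt_atTop 0] with n hn hpos
  rw [← mul_add]
  gcongr
  have hsq : (((√(n : ℝ))⁻¹ : ℝ) : ℂ) ^ 2 = (n : ℂ)⁻¹ := by
    rw [← ofReal_pow, inv_pow, Real.sq_sqrt (Nat.cast_nonneg n)]; simp
  have hb : ‖exp (-((v / 2 / n : ℝ) : ℂ)) - 1 - (-((v / 2 / n : ℝ) : ℂ))‖ ≤ (v / 2 / n) ^ 2 := by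
    refine (Complex.norm_exp_sub_one_sub_id_le ?_).trans_eq ?_
    · rw [norm_neg, norm_real]; exact hn
    · rw [norm_neg, norm_real, Real.norm_eq_abs, sq_abs]
  refine le_trans ?_ (add_le_add_right hb _)
  refine le_trans (le_of_eq ?_) (norm_sub_le _ _)
  congr 1
  rw [hsq]
  push_cast
  ring

end CharacteristicFunction

/-! ### Central limit theorem with fold-dependent summands. -/

section

/-- Every subsequence has a further subsequence converging almost everywhere, to which dominated
convergence applies. -/
theorem tendsto_integral_of_tendstoInMeasure_of_bound {Ω E : Type*} [MeasurableSpace Ω]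
    {P : Measure Ω} [IsProbabilityMeasure P] [NormedAddCommGroup E] [NormedSpace ℝ E]
    [CompleteSpace E] {X : ℕ → Ω → E} {c : E}
    (hm : ∀ n, AEStronglyMeasurable (X n) P) {C : ℝ} (hC : ∀ n ω, ‖X n ω‖ ≤ C)
    (h : TendstoInMeasure P X atTop (fun _ => c)) :
    Tendsto (fun n => ∫ ω, X n ω ∂P) atTop (𝓝 c) := by
  refine tendsto_of_subseq_tendsto fun ns hns => ?_
  obtain ⟨ms, -, hms⟩ := (h.comp hns).exists_seq_tendsto_ae
  refine ⟨ms, ?_⟩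
  have := tendsto_integral_of_dominated_convergence (μ := P) (fun _ => C)
    (F := fun n => X (ns (ms n))) (f := fun _ => c) (fun n => hm _) (integrable_const C)
    (fun n => Eventually.of_forall fun ω => hC _ ω) hms
  simpa using this

end

namespace ModelSelection

open Complex

variable {Ω 𝒳 : Type*} [MeasurableSpace Ω] [MeasurableSpace 𝒳] {P : Measure Ω}
  {D : ℕ → Ω → 𝒳} {K : ℕ} {A : (n : ℕ) → Ω → Fin n → Fin K}

theorem IsIID.identDistrib_comp (hD : IsIID P D) {f : 𝒳 → ℝ} (hf : Measurable f) (i : ℕ) :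
    IdentDistrib (fun ω => f (D i ω)) (fun ω => f (D 0 ω)) P P :=
  (hD.ident i).comp hf

theorem sum_apply_eq_sum_card_fold {n : ℕ} (a : Fin n → Fin K) (q : Fin K → ℝ) :
    ∑ i, q (a i) = ∑ k, (fold a k).card * q k := by
  rw [← Finset.sum_fiberwise (s := Finset.univ) (g := a)]
  refine Finset.sum_congr rfl fun k _ => ?_
  rw [Finset.sum_congr rfl (g := fun _ => q k) (fun i hi => by
    rw [(Finset.mem_filter.1 hi).2]), Finset.sum_const, nsmul_eq_mul]
  rfl

theorem IsIID.integral_exp_sum [IsProbabilityMeasure P]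
    (hD : IsIID P D) {ξ : Fin K → 𝒳 → ℝ} (hξ : ∀ k, Measurable (ξ k))
    {n : ℕ} (a : Fin n → Fin K) (t : ℝ) :
    ∫ ω, exp ((t * ∑ i, ξ (a i) (D i ω) : ℝ) * I) ∂P
      = ∏ i, charFun (P.map fun ω => ξ (a i) (D 0 ω)) t := by
  have hmeas : ∀ i : Fin n, Measurable fun ω => ξ (a i) (D i ω) :=
    fun i => (hξ _).comp (hD.measurable _)
  have hind : iIndepFun (fun (i : Fin n) ω => ξ (a i) (D i ω)) P :=
    (hD.indep.precomp Fin.val_injective).comp (fun i => ξ (a i)) fun i => hξ _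
  have h := congrFun (hind.charFun_map_fun_sum_eq_prod fun i => (hmeas i).aemeasurable) t
  rw [charFun_apply_real, integral_map (Finset.measurable_fun_sum _ fun i _ => hmeas i).aemeasurable
    (by fun_prop), Finset.prod_apply] at h
  convert! h using 1
  · simp
  · refine Finset.prod_congr rfl fun i _ => ?_
    rw [(hD.identDistrib_comp (hξ (a i)) i).map_eq]

theorem IsRandomSplit.tendsto_integral_exp_sum [IsProbabilityMeasure P]
    (hD : IsIID P D) (hA : IsRandomSplit P D A)
    {ξ : Fin K → 𝒳 → ℝ} (hξ : ∀ k, Measurable (ξ k))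
    (hL2 : ∀ k, MemLp (fun ω => ξ k (D 0 ω)) 2 P) (hc : ∀ k, ∫ ω, ξ k (D 0 ω) ∂P = 0) :
    Tendsto (fun n : ℕ => ∫ ω, exp (((√(n : ℝ))⁻¹ * ∑ i, ξ (A n ω i) (D i ω) : ℝ) * I) ∂P) atTop
      (𝓝 (exp (-((∑ k, 1 / (K : ℝ) * ∫ ω, ξ k (D 0 ω) ^ 2 ∂P : ℝ) : ℂ) / 2))) := by
  set q : Fin K → ℝ := fun k => ∫ ω, ξ k (D 0 ω) ^ 2 ∂P with hq
  have hq0 : ∀ k, 0 ≤ q k := fun k => integral_nonneg fun ω => sq_nonneg _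
  set z : ℕ → Fin K → ℂ := fun n k => charFun (P.map fun ω => ξ k (D 0 ω)) (√(n : ℝ))⁻¹ with hz
  set w : ℕ → Fin K → ℂ := fun n k => exp (-((q k / 2 / n : ℝ) : ℂ)) with hw
  have hz1 : ∀ n k, ‖z n k‖ ≤ 1 := fun n k => by
    have := Measure.isProbabilityMeasure_map (μ := P) ((hξ k).comp (hD.measurable 0)).aemeasurable
    exact norm_charFun_le_one (μ := P.map (ξ k ∘ D 0)) _
  have hw1 : ∀ n k, ‖w n k‖ ≤ 1 := fun n k => by
    have : (-((q k / 2 / n : ℝ) : ℂ)).re ≤ 0 := by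
      rw [neg_re, ofReal_re, neg_nonpos]
      have := hq0 k
      positivity
    simpa only [hw, norm_exp] using Real.exp_le_one_iff.2 this
  have hDm : Measurable fun ω i => D i ω := measurable_pi_lambda _ hD.measurable
  have hcond : ∀ n : ℕ, ∫ ω, exp (((√(n : ℝ))⁻¹ * ∑ i, ξ (A n ω i) (D i ω) : ℝ) * I) ∂P
      = ∫ ω, ∏ i, z n (A n ω i) ∂P := by
    intro n
    have := (hA.indep n).integral_eq_integral_integral (hA.measurable n) hDm
      (f := fun (a : Fin n → Fin K) (x : ℕ → 𝒳) =>
        exp (((√(n : ℝ))⁻¹ * ∑ i, ξ (a i) (x i) : ℝ) * I)) (C := 1)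
      (measurable_uncurry_of_countable fun a => by fun_prop)
      (fun a x => (norm_exp_ofReal_mul_I _).le)
    rw [this]
    refine integral_congr_ae (Eventually.of_forall fun ω => ?_)
    exact hD.integral_exp_sum hξ _ _
  have hAm : ∀ n (f : (Fin n → Fin K) → ℂ), AEStronglyMeasurable (fun ω => f (A n ω)) P :=
    fun n f => ((measurable_of_countable f).comp (hA.measurable n)).aestronglyMeasurable
  have hb : ∀ (u : Fin K → ℂ), (∀ k, ‖u k‖ ≤ 1) → ∀ {n : ℕ} (a : Fin n → Fin K),
      ‖∏ i, u (a i)‖ ≤ 1 := fun u hu n a => by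
    rw [norm_prod]
    exact Finset.prod_le_one (fun i _ => norm_nonneg _) (fun i _ => hu _)
  -- Summed over at most `n` observations per fold, the factorwise errors `o(1/n)` still tend to
  -- zero, uniformly in the split.
  have hdiff : Tendsto (fun n : ℕ => (∫ ω, ∏ i, z n (A n ω i) ∂P) - ∫ ω, ∏ i, w n (A n ω i) ∂P)
      atTop (𝓝 0) := by
    have hlim : Tendsto (fun n : ℕ => ∑ k, (n : ℝ) * ‖z n k - w n k‖) atTop (𝓝 0) := by
      have := tendsto_finsetSum Finset.univ fun k _ =>
        tendsto_mul_charFun_sub_exp (hL2 k) (hc k)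
      rwa [Finset.sum_const_zero] at this
    refine squeeze_zero_norm (fun n => ?_) hlim
    have hint : ∀ u : Fin K → ℂ, (∀ k, ‖u k‖ ≤ 1) →
        Integrable (fun ω => ∏ i, u (A n ω i)) P := fun u hu =>
      Integrable.of_bound (hAm n fun a => ∏ i, u (a i)) 1
        (Eventually.of_forall fun ω => hb u hu (A n ω))
    rw [← integral_sub (hint _ (hz1 n)) (hint _ (hw1 n))]
    refine (norm_integral_le_of_norm_le_const (C := ∑ k, (n : ℝ) * ‖z n k - w n k‖)
      (Eventually.of_forall fun ω => ?_)).trans_eq (by simp)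
    refine (norm_prod_sub_prod_le_sum _ _ _ (fun i => hz1 n _) fun i => hw1 n _).trans ?_
    rw [sum_apply_eq_sum_card_fold (A n ω) fun k => ‖z n k - w n k‖]
    gcongr with k
    simpa using Finset.card_le_univ (fold (A n ω) k)
  -- The product of exponentials depends on the split only through the fold fractions, and
  -- continuously, so their convergence in probability is enough.
  have hwlim : Tendsto (fun n : ℕ => ∫ ω, ∏ i, w n (A n ω i) ∂P) atTop
      (𝓝 (exp (-((∑ k, 1 / (K : ℝ) * q k : ℝ) : ℂ) / 2))) := by
    refine tendsto_integral_of_tendstoInMeasure_of_bound (C := 1)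
      (fun n => hAm n fun a => ∏ i, w n (a i))
      (fun n ω => hb (w n) (hw1 n) (A n ω)) ?_
    have hfr : TendstoInMeasure P (fun n ω k => ((fold (A n ω) k).card : ℝ) / (n : ℝ)) atTop
        (fun _ _ => 1 / (K : ℝ)) := TendstoInMeasure.pi hA.equal_size
    have := hfr.comp_continuousAt
      (φ := fun x : Fin K → ℝ => exp (-((∑ k, x k * q k : ℝ) : ℂ) / 2))
      (Continuous.continuousAt (by fun_prop))
    refine this.congr_left fun n => Eventually.of_forall fun ω => ?_
    simp only [hw]
    rw [← Complex.exp_sum]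
    congr 1
    have h1 := sum_apply_eq_sum_card_fold (A n ω) fun k => q k / 2 / n
    rw [Finset.sum_neg_distrib, ← ofReal_sum, h1, neg_div]
    congr 1
    push_cast
    rw [Finset.sum_div]
    refine Finset.sum_congr rfl fun k _ => ?_
    ring
  have := hdiff.add hwlim
  rw [zero_add] at this
  refine this.congr fun n => ?_
  rw [hcond, sub_add_cancel]

end ModelSelection

/-! ### Joint Gaussian limit of the fold sums. -/

noncomputable section

namespace ModelSelection

open Complex

variable {Ω 𝒳 : Type*} {K : ℕ}

/-- The normalized sums `n^{-1/2} ∑ f_a(D_i)` over the folds of a split. -/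
def foldScore (D : ℕ → Ω → 𝒳) (f : Fin 2 → 𝒳 → ℝ) {n : ℕ} (a : Fin n → Fin K) (ω : Ω) :
    EuclideanSpace ℝ (Fin K × Fin 2) :=
  WithLp.toLp 2 fun p => (√(n : ℝ))⁻¹ * ∑ i ∈ fold a p.1, f p.2 (D i ω)

/-- A linear functional of the fold sums is again a single sum over observations, with weights read
off from the fold label; this reduces the vector limit to the scalar one. -/
theorem inner_foldScore {D : ℕ → Ω → 𝒳} {f : Fin 2 → 𝒳 → ℝ} {n : ℕ} (a : Fin n → Fin K) (ω : Ω)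
    (t : EuclideanSpace ℝ (Fin K × Fin 2)) :
    inner ℝ (foldScore D f a ω) t
      = (√(n : ℝ))⁻¹ * ∑ i : Fin n, ∑ b, t (a i, b) * f b (D i ω) := by
  rw [PiLp.inner_apply, Fintype.sum_prod_type, ← Finset.sum_fiberwise (g := a), Finset.mul_sum]
  refine Finset.sum_congr rfl fun k _ => ?_
  rw [Finset.sum_comm, Finset.mul_sum]
  refine Finset.sum_congr rfl fun b _ => ?_
  simp only [foldScore, RCLike.inner_apply, conj_trivial]
  rw [mul_left_comm, Finset.mul_sum]
  congr 1
  refine Finset.sum_congr rfl fun i hi => ?_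
  rw [(Finset.mem_filter.1 hi).2]

variable [MeasurableSpace Ω]

/-- The covariance matrix of the limit of the normalized fold sums. -/
def foldCov (P : Measure Ω) (D : ℕ → Ω → 𝒳) (f : Fin 2 → 𝒳 → ℝ) (K : ℕ) :
    Matrix (Fin K × Fin 2) (Fin K × Fin 2) ℝ :=
  fun p q => if p.1 = q.1 then 1 / (K : ℝ) * ∫ ω, f p.2 (D 0 ω) * f q.2 (D 0 ω) ∂P else 0

variable {P : Measure Ω} {D : ℕ → Ω → 𝒳} {f : Fin 2 → 𝒳 → ℝ}

/-- Block-diagonality turns the matrix form into a sum of second moments, one per fold. Positivity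
and all later covariance computations come from this formula. -/
theorem dotProduct_foldCov_mulVec (hL2 : ∀ a, MemLp (fun ω => f a (D 0 ω)) 2 P)
    (x y : Fin K × Fin 2 → ℝ) :
    x ⬝ᵥ (foldCov P D f K).mulVec y = ∑ k, 1 / (K : ℝ) *
      ∫ ω, (∑ a, x (k, a) * f a (D 0 ω)) * (∑ a, y (k, a) * f a (D 0 ω)) ∂P := by
  have hint : ∀ k, ∫ ω, (∑ a, x (k, a) * f a (D 0 ω)) * (∑ a, y (k, a) * f a (D 0 ω)) ∂P
      = ∑ a, ∑ b, x (k, a) * y (k, b) * ∫ ω, f a (D 0 ω) * f b (D 0 ω) ∂P := by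
    intro k
    have hi : ∀ a b, Integrable (fun ω => f a (D 0 ω) * f b (D 0 ω)) P := fun a b =>
      (hL2 a).integrable_mul (hL2 b)
    have he : ∀ a b, Integrable (fun ω => x (k, a) * f a (D 0 ω) * (y (k, b) * f b (D 0 ω))) P :=
      fun a b => ((hi a b).const_mul (x (k, a) * y (k, b))).congr
        (Eventually.of_forall fun ω => by ring)
    simp_rw [Finset.sum_mul_sum]
    rw [integral_finsetSum _ fun a _ => integrable_finsetSum _ fun b _ => he a b]
    refine Finset.sum_congr rfl fun a _ => ?_
    rw [integral_finsetSum _ fun b _ => he a b]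
    refine Finset.sum_congr rfl fun b _ => ?_
    rw [← integral_const_mul]
    exact integral_congr_ae (Eventually.of_forall fun ω => by ring)
  simp_rw [hint, dotProduct, Matrix.mulVec, dotProduct, foldCov, Fintype.sum_prod_type,
    Finset.mul_sum]
  refine Finset.sum_congr rfl fun k _ => ?_
  refine Finset.sum_congr rfl fun a _ => ?_
  rw [Finset.sum_comm]
  refine Finset.sum_congr rfl fun b _ => ?_
  rw [Finset.sum_eq_single k]
  · simp; ring
  · intro l _ hl
    simp [hl.symm]
  · simp

theorem posSemidef_foldCov (hL2 : ∀ a, MemLp (fun ω => f a (D 0 ω)) 2 P) :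
    (foldCov P D f K).PosSemidef := by
  refine Matrix.PosSemidef.of_dotProduct_mulVec_nonneg ?_ fun x => ?_
  · ext p q
    simp only [Matrix.conjTranspose_apply, foldCov, star_trivial, eq_comm (a := q.1)]
    simp_rw [mul_comm (f q.2 _)]
  · rw [star_trivial, dotProduct_foldCov_mulVec hL2]
    refine Finset.sum_nonneg fun k _ => mul_nonneg (by positivity) (integral_nonneg fun ω => ?_)
    exact mul_self_nonneg _

variable [MeasurableSpace 𝒳]

theorem measurable_foldScore (hD : ∀ i, Measurable (D i)) (hf : ∀ a, Measurable (f a)) {n : ℕ}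
    (a : Fin n → Fin K) : Measurable (foldScore D f a) := by
  refine (WithLp.measurable_toLp 2 _).comp (measurable_pi_lambda _ fun p => ?_)
  have hm : ∀ i : Fin n, Measurable fun ω => f p.2 (D i ω) := fun i => (hf p.2).comp (hD i)
  fun_prop

theorem _root_.Measurable.comp_countable {α β : Type*} [MeasurableSpace α] [MeasurableSpace β]
    [Countable α] [MeasurableSingletonClass α] {A : Ω → α} (hA : Measurable A) {F : α → Ω → β}
    (hF : ∀ a, Measurable (F a)) : Measurable fun ω => F (A ω) ω :=
  (measurable_uncurry_of_countable hF).comp (hA.prodMk measurable_id)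

theorem IsRandomSplit.tendstoInDistribution_foldScore [IsProbabilityMeasure P]
    {A : (n : ℕ) → Ω → Fin n → Fin K} (hD : IsIID P D) (hA : IsRandomSplit P D A)
    (hf : ∀ a, Measurable (f a)) (hL2 : ∀ a, MemLp (fun ω => f a (D 0 ω)) 2 P)
    (hc : ∀ a, ∫ ω, f a (D 0 ω) ∂P = 0) :
    TendstoInDistribution (fun n ω => foldScore D f (A n ω) ω) atTop id (fun _ => P)
      (multivariateGaussian 0 (foldCov P D f K)) := by
  have hm : ∀ n, Measurable fun ω => foldScore D f (A n ω) ω := fun n =>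
    (hA.measurable n).comp_countable fun a => measurable_foldScore hD.measurable hf a
  refine ⟨fun n => (hm n).aemeasurable, aemeasurable_id,
    ProbabilityMeasure.tendsto_iff_tendsto_charFun.2 fun t => ?_⟩
  simp only [ProbabilityMeasure.coe_mk, Measure.map_id]
  rw [charFun_multivariateGaussian (posSemidef_foldCov hL2), dotProduct_foldCov_mulVec hL2]
  have h := hA.tendsto_integral_exp_sum hD (ξ := fun k x => ∑ b, t (k, b) * f b x)
    (fun k => by fun_prop) (fun k => memLp_finsetSum _ fun b _ => (hL2 b).const_mul _) (fun k => by
      rw [integral_finsetSum _ fun b _ => ((hL2 b).integrable one_le_two).const_mul _]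
      simp [integral_const_mul, hc])
  convert! h using 2 with n
  · rw [charFun_apply, integral_map (hm n).aemeasurable (by fun_prop)]
    simp_rw [inner_foldScore]
  · simp only [inner_zero_right, ofReal_zero, zero_mul, zero_sub, neg_div, sq]

end ModelSelection

end

/-! ### Remainders on random subsets. -/

noncomputable section

namespace ModelSelection

open scoped ENNReal

variable {Ω 𝒳 : Type*} {K : ℕ}

/-- The remainder in the linear expansion of an estimator computed on a subset of the data. -/
def subsetRemainder (D : ℕ → Ω → 𝒳) (T : Estimator 𝒳) (θ : ℝ) (ψ : 𝒳 → ℝ) {n : ℕ}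
    (s : Finset (Fin n)) (ω : Ω) : ℝ :=
  onSubset D T s ω - θ - (1 / (s.card : ℝ)) * ∑ i ∈ s, ψ (D i ω)

variable [MeasurableSpace 𝒳]

theorem measurable_onSubset [MeasurableSpace Ω] {D : ℕ → Ω → 𝒳} {T : Estimator 𝒳}
    (hD : ∀ i, Measurable (D i)) (hT : ∀ m, Measurable (T m)) {n : ℕ} (s : Finset (Fin n)) :
    Measurable (onSubset D T s) :=
  (hT _).comp (measurable_pi_lambda _ fun _ => hD _)

theorem measurable_onFull [MeasurableSpace Ω] {D : ℕ → Ω → 𝒳} {T : Estimator 𝒳}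
    (hD : ∀ i, Measurable (D i)) (hT : ∀ m, Measurable (T m)) (n : ℕ) :
    Measurable (onFull D T n) :=
  (hT _).comp (measurable_pi_lambda _ fun _ => hD _)

theorem measurable_remainder [MeasurableSpace Ω] {D : ℕ → Ω → 𝒳} {T : Estimator 𝒳} {θ : ℝ}
    {ψ : 𝒳 → ℝ} (hD : ∀ i, Measurable (D i)) (hT : ∀ m, Measurable (T m)) (hψ : Measurable ψ)
    (n : ℕ) : Measurable (remainder D T θ ψ n) := by
  have hm : ∀ i : ℕ, Measurable fun ω => ψ (D i ω) := fun i => hψ.comp (hD i)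
  have := measurable_onFull hD hT n
  unfold remainder
  fun_prop

theorem measurable_subsetRemainder [MeasurableSpace Ω] {D : ℕ → Ω → 𝒳} {T : Estimator 𝒳} {θ : ℝ}
    {ψ : 𝒳 → ℝ} (hD : ∀ i, Measurable (D i)) (hT : ∀ m, Measurable (T m)) (hψ : Measurable ψ)
    {n : ℕ} (s : Finset (Fin n)) : Measurable (subsetRemainder D T θ ψ s) := by
  have hm : ∀ i : Fin n, Measurable fun ω => ψ (D i ω) := fun i => hψ.comp (hD i)
  have := measurable_onSubset hD hT s
  unfold subsetRemainder
  fun_prop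

variable [MeasurableSpace Ω] {P : Measure Ω} {D : ℕ → Ω → 𝒳}
  {T : Estimator 𝒳} {θ : ℝ} {ψ : 𝒳 → ℝ}

/-- Listing `s` in increasing order is injective, so the listed observations have the joint law of
the first `s.card` ones, and both remainders are the same function of them. -/
theorem IsIID.identDistrib_subsetRemainder (hD : IsIID P D) (hT : ∀ m, Measurable (T m))
    (hψ : Measurable ψ) {n : ℕ} (s : Finset (Fin n)) :
    IdentDistrib (subsetRemainder D T θ ψ s) (remainder D T θ ψ s.card) P P := by
  have hinj : Function.Injective fun j : Fin s.card => ((s.orderEmbOfFin rfl j : Fin n) : ℕ) :=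
    Fin.val_injective.comp (s.orderEmbOfFin rfl).injective
  have hvec : IdentDistrib (fun ω (j : Fin s.card) => D (s.orderEmbOfFin rfl j) ω)
      (fun ω (j : Fin s.card) => D j ω) P P :=
    IdentDistrib.pi (fun j => (hD.ident _).trans (hD.ident _).symm)
      (hD.indep.precomp hinj) (hD.indep.precomp Fin.val_injective)
  have hF : Measurable fun x : Fin s.card → 𝒳 =>
      T s.card x - θ - (1 / (s.card : ℝ)) * ∑ j, ψ (x j) := by
    have := hT s.card
    fun_prop
  convert! hvec.comp hF using 1
  · ext ω
    simp only [subsetRemainder, onSubset, Function.comp_apply]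
    congr 2
    conv_lhs => rw [← s.map_orderEmbOfFin_univ rfl]
    rw [Finset.sum_map]
    rfl
  · ext ω
    simp only [remainder, onFull, Function.comp_apply, Finset.sum_range]

theorem IsAsympLinear.tendsto_mul_integral_sq_remainder (h : IsAsympLinear P D T θ ψ) :
    Tendsto (fun n : ℕ => (n : ℝ) * ∫ ω, remainder D T θ ψ n ω ^ 2 ∂P) atTop (𝓝 0) := by
  refine h.remainder_small.tendsto_div_nhds_zero.congr fun n => ?_
  rw [one_div, div_inv_eq_mul, mul_comm]

/-- Chebyshev, with `n ≤ m / r` to trade the factor `n` for `m`. The uniformity in `m` is needed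
because the subset size is random. -/
theorem IsAsympLinear.eventually_measure_le [IsProbabilityMeasure P]
    (h : IsAsympLinear P D T θ ψ) {r ε : ℝ} (hr : 0 < r)
    (hε : 0 < ε) {δ : ℝ≥0∞} (hδ : 0 < δ) :
    ∀ᶠ n : ℕ in atTop, ∀ m : ℕ, r * n ≤ m →
      P {ω | ε ≤ √(n : ℝ) * |remainder D T θ ψ m ω|} ≤ δ := by
  have hlim : Tendsto (fun m : ℕ => ENNReal.ofReal
      ((m * ∫ ω, remainder D T θ ψ m ω ^ 2 ∂P) / (r * ε ^ 2))) atTop (𝓝 0) := by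
    have := ENNReal.tendsto_ofReal (h.tendsto_mul_integral_sq_remainder.div_const (r * ε ^ 2))
    simpa using this
  obtain ⟨M, hM⟩ := eventually_atTop.1
    ((hlim.eventually_le_const hδ).and h.remainder_integrable)
  have hn : ∀ᶠ n : ℕ in atTop, (M : ℝ) ≤ r * n :=
    (tendsto_natCast_atTop_atTop.const_mul_atTop hr).eventually_ge_atTop _
  filter_upwards [hn, eventually_gt_atTop 0] with n hn hpos m hm
  have hn0 : (0 : ℝ) < n := by positivity
  obtain ⟨hle, hint⟩ := hM m (by exact_mod_cast hn.trans hm)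
  refine le_trans ?_ hle
  have hset : {ω | ε ≤ √(n : ℝ) * |remainder D T θ ψ m ω|}
      = {ω | ε / √(n : ℝ) ≤ |remainder D T θ ψ m ω|} := by
    ext ω
    simp only [Set.mem_ofPred_eq]
    rw [div_le_iff₀ (Real.sqrt_pos.2 hn0), mul_comm]
  rw [hset]
  refine (measure_le_abs_le_integral_sq hint (by positivity)).trans (ENNReal.ofReal_le_ofReal ?_)
  rw [div_pow, Real.sq_sqrt hn0.le, div_div_eq_mul_div, div_le_div_iff₀ (by positivity)
    (by positivity)]
  have h0 : 0 ≤ ∫ ω, remainder D T θ ψ m ω ^ 2 ∂P := integral_nonneg fun ω => sq_nonneg _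
  have := mul_le_mul_of_nonneg_left hm (mul_nonneg h0 (sq_nonneg ε))
  linarith

/-- The remainder of an estimator computed on a random subset that is independent of the data and
contains a non-vanishing fraction of the observations is of smaller order than `n^{-1/2}`. -/
theorem IsRandomSplit.tendstoInMeasure_subsetRemainder [IsProbabilityMeasure P]
    {A : (n : ℕ) → Ω → Fin n → Fin K}
    (hD : IsIID P D) (hA : IsRandomSplit P D A) (h : IsAsympLinear P D T θ ψ)
    (s : ∀ n, (Fin n → Fin K) → Finset (Fin n)) {r : ℝ} (hr : 0 < r)
    (hs : TendstoInMeasure P (fun (n : ℕ) ω => ((s n (A n ω)).card : ℝ) / n) atTop (fun _ => r)) :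
    TendstoInMeasure P (fun (n : ℕ) ω => √(n : ℝ) * subsetRemainder D T θ ψ (s n (A n ω)) ω) atTop
      (fun _ => 0) := by
  rw [tendstoInMeasure_iff_norm] at hs ⊢
  intro ε hε
  rw [ENNReal.tendsto_atTop_zero]
  intro δ hδ
  have hδ2 : 0 < δ / 2 := ENNReal.half_pos hδ.ne'
  have hbad := (hs (r / 2) (by positivity)).eventually_le_const hδ2
  have hgood := h.eventually_measure_le (r := r / 2) (by positivity) hε hδ2
  refine eventually_atTop.1 ?_
  filter_upwards [hbad, hgood, eventually_gt_atTop 0] with n hbad hgood hpos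
  have hn0 : (0 : ℝ) < n := by positivity
  have hDm : Measurable fun ω i => D i ω := measurable_pi_lambda _ hD.measurable
  -- The remainder is written on the coordinate process of the sequence space, so that the event
  -- becomes a measurable set of pairs (split, data).
  set S : Set ((Fin n → Fin K) × (ℕ → 𝒳)) :=
    {p | ε ≤ √(n : ℝ) * |subsetRemainder (fun i (x : ℕ → 𝒳) => x i) T θ ψ (s n p.1) p.2|} with hS
  have hSm : MeasurableSet S := by
    refine measurableSet_le measurable_const ?_
    refine Measurable.const_mul (continuous_abs.measurable.comp ?_) _
    exact measurable_uncurry_of_countable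
      (f := fun a x => subsetRemainder (fun i (x : ℕ → 𝒳) => x i) T θ ψ (s n a) x) fun a =>
        measurable_subsetRemainder (fun i => measurable_pi_apply i) h.measurable_estimator
          h.measurable_influence _
  set B : Set Ω := {ω | r / 2 ≤ ‖((s n (A n ω)).card : ℝ) / n - r‖} with hB
  have hBm : MeasurableSet B := by
    have : Measurable fun ω => ‖((s n (A n ω)).card : ℝ) / n - r‖ :=
      (measurable_of_countable fun a : Fin n → Fin K => ‖((s n a).card : ℝ) / n - r‖).comp
        (hA.measurable n)
    exact measurableSet_le measurable_const this
  have hkey : P {ω | ε ≤ ‖√(n : ℝ) * subsetRemainder D T θ ψ (s n (A n ω)) ω - 0‖}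
      = ∫⁻ ω, P {ω' | (A n ω, fun i => D i ω') ∈ S} ∂P := by
    rw [← (hA.indep n).measure_eq_lintegral (hA.measurable n) hDm hSm]
    congr 1
    ext ω
    simp only [Set.mem_ofPred_eq, hS, sub_zero, norm_mul, Real.norm_eq_abs,
      abs_of_nonneg (Real.sqrt_nonneg _)]
    rfl
  rw [hkey]
  -- Either the subset fraction is off by at least `r / 2`, which is rare, or the frozen subset has
  -- at least `r n / 2` elements and the uniform bound applies.
  have hpt : ∀ ω, P {ω' | (A n ω, fun i => D i ω') ∈ S} ≤ B.indicator 1 ω + δ / 2 := by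
    intro ω
    by_cases hω : ω ∈ B
    · rw [Set.indicator_of_mem hω]
      exact prob_le_one.trans le_self_add
    · rw [Set.indicator_of_notMem hω, zero_add]
      simp only [hB, Set.mem_ofPred_eq, not_le, Real.norm_eq_abs] at hω
      have hcard : r / 2 * n ≤ ((s n (A n ω)).card : ℝ) := by
        rw [← le_div_iff₀ hn0]
        have := (abs_lt.1 hω).1
        linarith
      refine le_trans (le_of_eq ?_) (hgood _ hcard)
      have hid := hD.identDistrib_subsetRemainder (θ := θ) h.measurable_estimator
        h.measurable_influence (s n (A n ω))
      have hset : MeasurableSet {x : ℝ | ε ≤ √(n : ℝ) * |x|} :=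
        measurableSet_le measurable_const (by fun_prop)
      exact hid.measure_mem_eq hset
  refine (lintegral_mono hpt).trans ?_
  rw [lintegral_add_right _ measurable_const, lintegral_indicator_one hBm, lintegral_const,
    measure_univ, mul_one]
  exact (add_le_add_left hbad _).trans_eq (ENNReal.add_halves δ)

end ModelSelection

end

/-! ### Limits of the normalized estimation errors. -/

noncomputable section

namespace ModelSelection

variable {Ω 𝒳 : Type*} {K : ℕ}

/-- The limit, as a function of the limiting fold sums, of the normalized difference between the
candidate estimator on the complement of a fold and the reference estimator on that fold. -/
def cvForm (x : EuclideanSpace ℝ (Fin K × Fin 2)) (k : Fin K) : ℝ :=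
  (K : ℝ) / ((K : ℝ) - 1) * ∑ j ∈ {k}ᶜ, x (j, 0) - K * x (k, 1)

/-- The limit, as a function of the limiting fold sums, of the normalized difference between the
candidate and the reference estimator on the whole data set. -/
def fullForm (x : EuclideanSpace ℝ (Fin K × Fin 2)) : ℝ :=
  ∑ k, (x (k, 0) - x (k, 1))

/-- The normalized errors `√n (T(D^{1,k}) - T₀(D^{0,k}) - δ)`. -/
def cvError (D : ℕ → Ω → 𝒳) (T T₀ : Estimator 𝒳) (δ : ℝ) {n : ℕ} (a : Fin n → Fin K) (ω : Ω)
    (k : Fin K) : ℝ :=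
  √(n : ℝ) * (onSubset D T (fold a k)ᶜ ω - onSubset D T₀ (fold a k) ω - δ)

/-- The normalized error `√n (T(D) - T₀(D) - δ)`. -/
def fullError (D : ℕ → Ω → 𝒳) (T T₀ : Estimator 𝒳) (δ : ℝ) (n : ℕ) (ω : Ω) : ℝ :=
  √(n : ℝ) * (onFull D T n ω - onFull D T₀ n ω - δ)

/-- Each candidate fold sum occurs in `K - 1` training sets with weight `K / (K - 1)`, and each
reference fold sum once with weight `K`. -/
theorem sum_cvForm (hK : 2 ≤ K) (x : EuclideanSpace ℝ (Fin K × Fin 2)) :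
    ∑ k, cvForm x k = K * fullForm x := by
  have hK1 : (K : ℝ) - 1 ≠ 0 := by
    have : (2 : ℝ) ≤ K := by exact_mod_cast hK
    linarith
  have h : ∀ k, ∑ j ∈ ({k}ᶜ : Finset (Fin K)), x (j, 0) = ∑ j, x (j, 0) - x (k, 0) := fun k => by
    rw [← Finset.sum_compl_add_sum {k}, Finset.sum_singleton, add_sub_cancel_right]
  simp only [cvForm, fullForm, h, Finset.sum_sub_distrib, ← Finset.mul_sum, Finset.sum_const,
    Finset.card_univ, Fintype.card_fin, nsmul_eq_mul]
  field_simp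

theorem sum_compl_fold {n : ℕ} (a : Fin n → Fin K) (k : Fin K) (q : Fin n → ℝ) :
    ∑ i ∈ (fold a k)ᶜ, q i = ∑ j ∈ {k}ᶜ, ∑ i ∈ fold a j, q i := by
  have h1 := Finset.sum_fiberwise (s := Finset.univ) (g := a) (f := q)
  rw [← Finset.sum_compl_add_sum (fold a k)] at h1
  rw [← Finset.sum_compl_add_sum {k}, Finset.sum_singleton] at h1
  exact (add_right_cancel h1).symm

theorem sqrt_mul_div_eq (n : ℕ) (c y : ℝ) :
    √(n : ℝ) * (1 / c * y) = (n : ℝ) / c * ((√(n : ℝ))⁻¹ * y) := by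
  have h : √(n : ℝ) = n * (√(n : ℝ))⁻¹ := by
    rw [← div_eq_mul_inv, Real.div_sqrt]
  calc √(n : ℝ) * (1 / c * y) = (n * (√(n : ℝ))⁻¹) * (1 / c * y) := by rw [← h]
    _ = _ := by ring

theorem cvError_eq (D : ℕ → Ω → 𝒳) (T T₀ : Estimator 𝒳) (θ θ₀ : ℝ) (ψ ψ₀ : 𝒳 → ℝ) {n : ℕ}
    (a : Fin n → Fin K) (ω : Ω) (k : Fin K) :
    cvError D T T₀ (θ - θ₀) a ω k
      = (n : ℝ) / ((fold a k)ᶜ.card : ℝ) * ∑ j ∈ {k}ᶜ, foldScore D ![ψ, ψ₀] a ω (j, 0)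
        + √(n : ℝ) * subsetRemainder D T θ ψ (fold a k)ᶜ ω
        - (n : ℝ) / ((fold a k).card : ℝ) * foldScore D ![ψ, ψ₀] a ω (k, 1)
        - √(n : ℝ) * subsetRemainder D T₀ θ₀ ψ₀ (fold a k) ω := by
  simp only [foldScore, ← Finset.mul_sum, Matrix.cons_val_zero, Matrix.cons_val_one]
  rw [← sum_compl_fold a k fun i => ψ (D i ω), ← sqrt_mul_div_eq, ← sqrt_mul_div_eq, cvError,
    subsetRemainder, subsetRemainder]
  ring

/-- The left side does not involve the split: regrouping the full sum by folds expresses this error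
through the same vector as the cross-validation errors. -/
theorem fullError_eq (D : ℕ → Ω → 𝒳) (T T₀ : Estimator 𝒳) (θ θ₀ : ℝ) (ψ ψ₀ : 𝒳 → ℝ) {n : ℕ}
    (hn : n ≠ 0) (a : Fin n → Fin K) (ω : Ω) :
    fullError D T T₀ (θ - θ₀) n ω
      = fullForm (foldScore D ![ψ, ψ₀] a ω)
        + (√(n : ℝ) * remainder D T θ ψ n ω + -1 * (√(n : ℝ) * remainder D T₀ θ₀ ψ₀ n ω)) := by
  have h : ∀ q : 𝒳 → ℝ, ∑ k, (√(n : ℝ))⁻¹ * ∑ i ∈ fold a k, q (D i ω)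
      = √(n : ℝ) * (1 / (n : ℝ) * ∑ i ∈ Finset.range n, q (D i ω)) := fun q => by
    rw [← Finset.mul_sum, sqrt_mul_div_eq, div_self (Nat.cast_ne_zero.2 hn), one_mul,
      Finset.sum_range]
    congr 1
    exact Finset.sum_fiberwise (s := Finset.univ) (g := a) (f := fun i : Fin n => q (D i ω))
  simp only [fullForm, foldScore, Matrix.cons_val_zero, Matrix.cons_val_one,
    Finset.sum_sub_distrib, h]
  simp only [fullError, remainder]
  ring

variable [MeasurableSpace 𝒳] [MeasurableSpace Ω] {P : Measure Ω}
  {D : ℕ → Ω → 𝒳} {A : (n : ℕ) → Ω → Fin n → Fin K}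

theorem IsRandomSplit.tendstoInMeasure_card_compl (hA : IsRandomSplit P D A) (k : Fin K) :
    TendstoInMeasure P (fun (n : ℕ) ω => ((fold (A n ω) k)ᶜ.card : ℝ) / n) atTop
      (fun _ => 1 - 1 / (K : ℝ)) := by
  refine ((hA.equal_size k).comp_continuousAt (φ := fun x : ℝ => 1 - x) (by fun_prop)).congr'
    ?_ (Eventually.of_forall fun _ => rfl)
  filter_upwards [eventually_ne_atTop 0] with n hn
  refine Eventually.of_forall fun ω => ?_
  have hn' : (n : ℝ) ≠ 0 := Nat.cast_ne_zero.2 hn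
  have hle : (fold (A n ω) k).card ≤ n := by simpa using Finset.card_le_univ (fold (A n ω) k)
  simp only [Finset.card_compl, Fintype.card_fin]
  rw [Nat.cast_sub hle, sub_div, div_self hn']

theorem IsRandomSplit.tendstoInDistribution_cvError [IsProbabilityMeasure P]
    (hK : 2 ≤ K) (hD : IsIID P D)
    (hA : IsRandomSplit P D A) {T T₀ : Estimator 𝒳} {θ θ₀ : ℝ} {ψ ψ₀ : 𝒳 → ℝ}
    (hT : IsAsympLinear P D T θ ψ) (hT₀ : IsAsympLinear P D T₀ θ₀ ψ₀)
    (hS : TendstoInDistribution (fun n ω => foldScore D ![ψ, ψ₀] (A n ω) ω) atTop id (fun _ => P)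
      (multivariateGaussian 0 (foldCov P D ![ψ, ψ₀] K))) :
    TendstoInDistribution (fun n ω => cvError D T T₀ (θ - θ₀) (A n ω) ω) atTop cvForm
      (fun _ => P) (multivariateGaussian 0 (foldCov P D ![ψ, ψ₀] K)) := by
  have hK2 : (2 : ℝ) ≤ K := by exact_mod_cast hK
  have hr0 : (0 : ℝ) < 1 / K := by positivity
  have hr1 : (0 : ℝ) < 1 - 1 / K := by
    rw [sub_pos, div_lt_one (by linarith)]; linarith
  -- Everything random besides the fold sums: inverse size fractions and remainders, all with
  -- constant limits, so Slutsky applies.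
  set Y : (n : ℕ) → Ω → Fin K → Fin 4 → ℝ := fun n ω k =>
    ![(n : ℝ) / ((fold (A n ω) k)ᶜ.card : ℝ), (n : ℝ) / ((fold (A n ω) k).card : ℝ),
      √(n : ℝ) * subsetRemainder D T θ ψ (fold (A n ω) k)ᶜ ω,
      √(n : ℝ) * subsetRemainder D T₀ θ₀ ψ₀ (fold (A n ω) k) ω] with hY
  have hYlim : TendstoInMeasure P Y atTop
      (fun _ _ => ![(K : ℝ) / ((K : ℝ) - 1), (K : ℝ), 0, 0]) := by
    refine TendstoInMeasure.pi fun k => TendstoInMeasure.pi fun i => ?_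
    fin_cases i
    · have h := (hA.tendstoInMeasure_card_compl k).comp_continuousAt (φ := fun x : ℝ => x⁻¹)
        (continuousAt_inv₀ hr1.ne')
      simp only [inv_div] at h
      convert! h using 2
      simp only [Fin.zero_eta, Matrix.cons_val_zero]
      have : (K : ℝ) - 1 ≠ 0 := by linarith
      field_simp
    · have h := (hA.equal_size k).comp_continuousAt (φ := fun x : ℝ => x⁻¹)
        (continuousAt_inv₀ hr0.ne')
      simp only [inv_div] at h
      convert! h using 2
      simp
    · exact hA.tendstoInMeasure_subsetRemainder hD hT (fun n a => (fold a k)ᶜ) hr1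
        (hA.tendstoInMeasure_card_compl k)
    · exact hA.tendstoInMeasure_subsetRemainder hD hT₀ (fun n a => fold a k) hr0
        (hA.equal_size k)
  have hYm : ∀ n, Measurable (Y n) := fun n => by
    refine (hA.measurable n).comp_countable (F := fun a ω k =>
      ![(n : ℝ) / ((fold a k)ᶜ.card : ℝ), (n : ℝ) / ((fold a k).card : ℝ),
      √(n : ℝ) * subsetRemainder D T θ ψ (fold a k)ᶜ ω,
      √(n : ℝ) * subsetRemainder D T₀ θ₀ ψ₀ (fold a k) ω]) fun a => ?_
    refine measurable_pi_lambda _ fun k => measurable_pi_lambda _ fun i => ?_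
    have h1 := measurable_subsetRemainder (θ := θ) hD.measurable hT.measurable_estimator
      hT.measurable_influence (fold a k)ᶜ
    have h2 := measurable_subsetRemainder (θ := θ₀) hD.measurable hT₀.measurable_estimator
      hT₀.measurable_influence (fold a k)
    fin_cases i
    · exact measurable_const
    · exact measurable_const
    · exact h1.const_mul _
    · exact h2.const_mul _
  have h := hS.continuous_comp_prodMk_of_tendstoInMeasure_const
    (g := fun p : EuclideanSpace ℝ (Fin K × Fin 2) × (Fin K → Fin 4 → ℝ) => fun k =>
      p.2 k 0 * ∑ j ∈ {k}ᶜ, p.1 (j, 0) + p.2 k 2 - p.2 k 1 * p.1 (k, 1) - p.2 k 3)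
    (by fun_prop) hYlim (fun n => (hYm n).aemeasurable)
  convert! h using 1
  · ext n ω k
    rw [cvError_eq D T T₀ θ θ₀ ψ ψ₀]
    simp [hY]
  · ext x k
    simp [cvForm]

theorem IsAsympLinear.tendstoInMeasure_remainder [IsProbabilityMeasure P]
    {T : Estimator 𝒳} {θ : ℝ} {ψ : 𝒳 → ℝ}
    (hT : IsAsympLinear P D T θ ψ) :
    TendstoInMeasure P (fun (n : ℕ) ω => √(n : ℝ) * remainder D T θ ψ n ω) atTop
      (fun _ => 0) := by
  rw [tendstoInMeasure_iff_norm]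
  intro ε hε
  rw [ENNReal.tendsto_atTop_zero]
  intro δ hδ
  refine eventually_atTop.1 ?_
  filter_upwards [hT.eventually_measure_le one_pos hε hδ] with n hn
  refine le_trans (le_of_eq ?_) (hn n (by simp))
  congr 1
  ext ω
  simp [abs_of_nonneg (Real.sqrt_nonneg _)]

theorem tendstoInDistribution_fullError [IsProbabilityMeasure P] (hD : IsIID P D)
    {T T₀ : Estimator 𝒳} {θ θ₀ : ℝ} {ψ ψ₀ : 𝒳 → ℝ}
    (hT : IsAsympLinear P D T θ ψ) (hT₀ : IsAsympLinear P D T₀ θ₀ ψ₀)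
    (hS : TendstoInDistribution (fun n ω => foldScore D ![ψ, ψ₀] (A n ω) ω) atTop id (fun _ => P)
      (multivariateGaussian 0 (foldCov P D ![ψ, ψ₀] K))) :
    TendstoInDistribution (fun n ω => fullError D T T₀ (θ - θ₀) n ω) atTop fullForm
      (fun _ => P) (multivariateGaussian 0 (foldCov P D ![ψ, ψ₀] K)) := by
  have hfm : Continuous (fullForm (K := K)) := by unfold fullForm; fun_prop
  have hUm : ∀ n, Measurable (fullError D T T₀ (θ - θ₀) n) := fun n => by
    have h1 := measurable_onFull hD.measurable hT.measurable_estimator n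
    have h2 := measurable_onFull hD.measurable hT₀.measurable_estimator n
    unfold fullError
    fun_prop
  have hlin : TendstoInDistribution (fun n ω => fullForm (foldScore D ![ψ, ψ₀] (A n ω) ω)) atTop
      fullForm (fun _ => P) (multivariateGaussian 0 (foldCov P D ![ψ, ψ₀] K)) :=
    hS.continuous_comp (g := fullForm) hfm
  refine tendstoInDistribution_of_tendstoInMeasure_sub _ _ hlin ?_
    fun n => (hUm n).aemeasurable
  have h := hT.tendstoInMeasure_remainder.add_const_lim
    ((tendstoInMeasure_const_of_tendsto (μ := P) (tendsto_const_nhds (x := (-1 : ℝ)))).mul_const_lim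
      hT₀.tendstoInMeasure_remainder)
  simp only [mul_zero, add_zero] at h
  refine h.congr' ?_ (Eventually.of_forall fun _ => rfl)
  filter_upwards [eventually_ne_atTop 0] with n hn
  refine Eventually.of_forall fun ω => ?_
  simp only [Pi.sub_apply]
  rw [fullError_eq D T T₀ θ θ₀ ψ ψ₀ hn (A n ω), add_sub_cancel_left]

end ModelSelection

end

/-! ### Asymptotics of the mean-squared error. -/

noncomputable section

theorem integral_add_add {Ω : Type*} [MeasurableSpace Ω] {P : Measure Ω} {f g h : Ω → ℝ}
    (hf : Integrable f P) (hg : Integrable g P) (hh : Integrable h P) :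
    ∫ ω, f ω + g ω + h ω ∂P = ∫ ω, f ω ∂P + ∫ ω, g ω ∂P + ∫ ω, h ω ∂P := by
  rw [← integral_add hf hg]
  exact integral_add (hf.add hg) hh

/-- Cauchy–Schwarz from the discriminant of the nonnegative quadratic `t ↦ E[(tX + Y)²]`. -/
theorem MeasureTheory.MemLp.sq_integral_mul_le {Ω : Type*} [MeasurableSpace Ω] {P : Measure Ω}
    {X Y : Ω → ℝ} (hX : MemLp X 2 P) (hY : MemLp Y 2 P) :
    (∫ ω, X ω * Y ω ∂P) ^ 2 ≤ (∫ ω, X ω ^ 2 ∂P) * ∫ ω, Y ω ^ 2 ∂P := by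
  have h : ∀ t : ℝ, 0 ≤ (∫ ω, X ω ^ 2 ∂P) * (t * t) + (2 * ∫ ω, X ω * Y ω ∂P) * t
      + ∫ ω, Y ω ^ 2 ∂P := fun t => by
    have h0 : 0 ≤ ∫ ω, (t * X ω + Y ω) ^ 2 ∂P := integral_nonneg fun ω => sq_nonneg _
    have he : ∀ ω, (t * X ω + Y ω) ^ 2 = t * t * X ω ^ 2 + 2 * t * (X ω * Y ω) + Y ω ^ 2 :=
      fun ω => by ring
    have hXY : Integrable (fun ω => X ω * Y ω) P := hX.integrable_mul hY
    simp_rw [he] at h0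
    rw [integral_add_add (hX.integrable_sq.const_mul _) (hXY.const_mul _) hY.integrable_sq,
      integral_const_mul, integral_const_mul] at h0
    linarith
  have := discrim_le_zero h
  rw [discrim] at this
  linarith

namespace ModelSelection

theorem onFull_sub_eq {Ω 𝒳 : Type*} (D : ℕ → Ω → 𝒳) (T : Estimator 𝒳) (θ : ℝ) (ψ : 𝒳 → ℝ) (n : ℕ)
    (ω : Ω) :
    onFull D T n ω - θ = 1 / (n : ℝ) * ∑ i ∈ Finset.range n, ψ (D i ω) + remainder D T θ ψ n ω := by
  rw [remainder]; ring

variable {Ω 𝒳 : Type*} [MeasurableSpace 𝒳] [MeasurableSpace Ω] {P : Measure Ω}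
  {D : ℕ → Ω → 𝒳}

theorem IsIID.memLp_comp (hD : IsIID P D) {ψ : 𝒳 → ℝ} (hψ : Measurable ψ)
    (hL2 : MemLp (fun ω => ψ (D 0 ω)) 2 P) (i : ℕ) : MemLp (fun ω => ψ (D i ω)) 2 P :=
  (hD.identDistrib_comp hψ i).memLp_iff.2 hL2

theorem IsIID.memLp_mean (hD : IsIID P D) {ψ : 𝒳 → ℝ} (hψ : Measurable ψ)
    (hL2 : MemLp (fun ω => ψ (D 0 ω)) 2 P) (n : ℕ) :
    MemLp (fun ω => 1 / (n : ℝ) * ∑ i ∈ Finset.range n, ψ (D i ω)) 2 P :=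
  (memLp_finsetSum _ fun i _ => hD.memLp_comp hψ hL2 i).const_mul _

theorem IsIID.integral_mean_eq_zero [IsProbabilityMeasure P]
    (hD : IsIID P D) {ψ : 𝒳 → ℝ} (hψ : Measurable ψ)
    (hL2 : MemLp (fun ω => ψ (D 0 ω)) 2 P) (hc : ∫ ω, ψ (D 0 ω) ∂P = 0) (n : ℕ) :
    ∫ ω, 1 / (n : ℝ) * ∑ i ∈ Finset.range n, ψ (D i ω) ∂P = 0 := by
  rw [integral_const_mul, integral_finsetSum _ fun i _ =>
    (hD.memLp_comp hψ hL2 i).integrable one_le_two]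
  simp_rw [fun i => (hD.identDistrib_comp hψ i).integral_eq, hc]
  simp

theorem IsIID.mul_integral_sq_mean [IsProbabilityMeasure P]
    (hD : IsIID P D) {ψ : 𝒳 → ℝ} (hψ : Measurable ψ)
    (hL2 : MemLp (fun ω => ψ (D 0 ω)) 2 P) (hc : ∫ ω, ψ (D 0 ω) ∂P = 0) {n : ℕ} (hn : n ≠ 0) :
    n * ∫ ω, (1 / (n : ℝ) * ∑ i ∈ Finset.range n, ψ (D i ω)) ^ 2 ∂P
      = ∫ ω, ψ (D 0 ω) ^ 2 ∂P := by
  have hn' : (n : ℝ) ≠ 0 := Nat.cast_ne_zero.2 hn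
  have h0 := hD.integral_mean_eq_zero hψ hL2 hc n
  have hi : ∀ i : ℕ, Var[fun ω => ψ (D i ω); P] = ∫ ω, ψ (D 0 ω) ^ 2 ∂P := fun i => by
    rw [(hD.identDistrib_comp hψ i).variance_eq,
      variance_of_integral_eq_zero hL2.aestronglyMeasurable.aemeasurable hc]
  have hind : iIndepFun (fun i ω => ψ (D i ω)) P := hD.indep.comp (fun _ => ψ) fun _ => hψ
  have hs := IndepFun.variance_sum (s := Finset.range n) (X := fun i ω => ψ (D i ω))
    (fun i _ => hD.memLp_comp hψ hL2 i) fun i _ j _ hij => hind.indepFun hij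
  simp only [hi, Finset.sum_const, Finset.card_range, nsmul_eq_mul] at hs
  rw [← variance_of_integral_eq_zero
    (hD.memLp_mean hψ hL2 n).aestronglyMeasurable.aemeasurable h0, variance_const_mul]
  have : Var[fun ω => ∑ i ∈ Finset.range n, ψ (D i ω); P]
      = n * ∫ ω, ψ (D 0 ω) ^ 2 ∂P := by
    rw [← hs]; congr 1; ext ω; simp
  rw [this]
  field_simp

theorem IsAsympLinear.eventually_memLp_remainder (hD : IsIID P D) {T : Estimator 𝒳} {θ : ℝ}
    {ψ : 𝒳 → ℝ} (hT : IsAsympLinear P D T θ ψ) :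
    ∀ᶠ n in atTop, MemLp (remainder D T θ ψ n) 2 P := by
  filter_upwards [hT.remainder_integrable] with n hn
  exact (memLp_two_iff_integrable_sq (measurable_remainder hD.measurable hT.measurable_estimator
    hT.measurable_influence n).aestronglyMeasurable).2 hn

theorem IsAsympLinear.eventually_memLp [IsProbabilityMeasure P]
    (hD : IsIID P D) {T : Estimator 𝒳} {θ : ℝ}
    {ψ : 𝒳 → ℝ} (hT : IsAsympLinear P D T θ ψ) :
    ∀ᶠ n in atTop, MemLp (fun ω => onFull D T n ω - θ) 2 P := by
  filter_upwards [hT.eventually_memLp_remainder hD] with n hn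
  simp_rw [onFull_sub_eq D T θ ψ]
  exact (hD.memLp_mean hT.measurable_influence hT.memLp n).add hn

/-- The normalized second moment of the error converges to that of the influence function. -/
theorem IsAsympLinear.tendsto_mul_integral_sq [IsProbabilityMeasure P]
    (hD : IsIID P D) {T : Estimator 𝒳} {θ : ℝ}
    {ψ : 𝒳 → ℝ} (hT : IsAsympLinear P D T θ ψ) :
    Tendsto (fun n : ℕ => (n : ℝ) * ∫ ω, (onFull D T n ω - θ) ^ 2 ∂P) atTop
      (𝓝 (∫ ω, ψ (D 0 ω) ^ 2 ∂P)) := by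
  set v := ∫ ω, ψ (D 0 ω) ^ 2 ∂P with hv
  set L : ℕ → Ω → ℝ := fun n ω => 1 / (n : ℝ) * ∑ i ∈ Finset.range n, ψ (D i ω) with hL
  set e : ℕ → Ω → ℝ := remainder D T θ ψ with he
  -- By Cauchy–Schwarz the scaled cross term is at most the square root of `v` times the scaled
  -- second moment of the remainder.
  have hcross : Tendsto (fun n : ℕ => (n : ℝ) * ∫ ω, L n ω * e n ω ∂P) atTop (𝓝 0) := by
    have h1 : Tendsto (fun n : ℕ => √(v * ((n : ℝ) * ∫ ω, e n ω ^ 2 ∂P))) atTop (𝓝 0) := by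
      simpa using (hT.tendsto_mul_integral_sq_remainder.const_mul v).sqrt
    refine squeeze_zero_norm' ?_ h1
    filter_upwards [hT.eventually_memLp_remainder hD, eventually_ne_atTop 0] with n hn hn0
    refine Real.le_sqrt_of_sq_le ?_
    rw [Real.norm_eq_abs, sq_abs, mul_pow, hv,
      ← hD.mul_integral_sq_mean hT.measurable_influence hT.memLp hT.centered hn0]
    have := (hD.memLp_mean hT.measurable_influence hT.memLp n).sq_integral_mul_le hn
    calc (n : ℝ) ^ 2 * (∫ ω, L n ω * e n ω ∂P) ^ 2
        ≤ (n : ℝ) ^ 2 * ((∫ ω, L n ω ^ 2 ∂P) * ∫ ω, e n ω ^ 2 ∂P) := by gcongr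
      _ = _ := by ring
  have hlim := ((tendsto_const_nhds (x := v)).add (hcross.const_mul 2)).add
    hT.tendsto_mul_integral_sq_remainder
  simp only [mul_zero, add_zero] at hlim
  refine hlim.congr' ?_
  filter_upwards [hT.eventually_memLp_remainder hD, eventually_ne_atTop 0] with n hn hn0
  have hLm := hD.memLp_mean hT.measurable_influence hT.memLp n
  have hsq : ∀ ω, (onFull D T n ω - θ) ^ 2 = L n ω ^ 2 + 2 * (L n ω * e n ω) + e n ω ^ 2 :=
    fun ω => by rw [onFull_sub_eq D T θ ψ]; ring
  have hi : Integrable (fun ω => L n ω * e n ω) P := hLm.integrable_mul hn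
  simp_rw [hsq]
  rw [integral_add_add (f := fun ω => L n ω ^ 2) hLm.integrable_sq (hi.const_mul 2)
    hn.integrable_sq, integral_const_mul, hv,
    ← hD.mul_integral_sq_mean hT.measurable_influence hT.memLp hT.centered hn0]
  ring

/-- The linear part is centered, so the bias is the mean of the remainder, bounded by its root mean
square. -/
theorem IsAsympLinear.tendsto_sqrt_mul_integral [IsProbabilityMeasure P]
    (hD : IsIID P D) {T : Estimator 𝒳} {θ : ℝ}
    {ψ : 𝒳 → ℝ} (hT : IsAsympLinear P D T θ ψ) :
    Tendsto (fun n : ℕ => √(n : ℝ) * ∫ ω, (onFull D T n ω - θ) ∂P) atTop (𝓝 0) := by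
  have h1 : Tendsto (fun n : ℕ => √((n : ℝ) * ∫ ω, remainder D T θ ψ n ω ^ 2 ∂P)) atTop
      (𝓝 0) := by
    simpa using hT.tendsto_mul_integral_sq_remainder.sqrt
  refine squeeze_zero_norm' ?_ h1
  filter_upwards [hT.eventually_memLp_remainder hD] with n hn
  simp_rw [onFull_sub_eq D T θ ψ]
  rw [integral_add ((hD.memLp_mean hT.measurable_influence hT.memLp n).integrable one_le_two)
    (hn.integrable one_le_two), hD.integral_mean_eq_zero hT.measurable_influence hT.memLp
    hT.centered, zero_add]
  refine Real.le_sqrt_of_sq_le ?_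
  rw [Real.norm_eq_abs, sq_abs, mul_pow, Real.sq_sqrt (Nat.cast_nonneg n)]
  have := (memLp_const (1 : ℝ)).sq_integral_mul_le hn
  simp only [one_mul, one_pow, integral_const, probReal_univ, smul_eq_mul, mul_one] at this
  gcongr

theorem IsAsympLinear.tendsto_mul_mse [IsProbabilityMeasure P]
    (hD : IsIID P D) {T : Estimator 𝒳} {θ : ℝ}
    {ψ : 𝒳 → ℝ} (hT : IsAsympLinear P D T θ ψ) :
    Tendsto (fun n : ℕ => (n : ℝ) * mse P D T θ n) atTop (𝓝 (∫ ω, ψ (D 0 ω) ^ 2 ∂P)) :=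
  hT.tendsto_mul_integral_sq hD

/-- Expanding around `θ`, the quadratic term is `O(1/n)` and the cross term is a multiple of the
bias, which is `o(n^{-1/2})`. -/
theorem IsAsympLinear.tendsto_sqrt_mul_mse_sub [IsProbabilityMeasure P]
    (hD : IsIID P D) {T : Estimator 𝒳} {θ : ℝ}
    {ψ : 𝒳 → ℝ} (hT : IsAsympLinear P D T θ ψ) (θ₀ : ℝ) :
    Tendsto (fun n : ℕ => √(n : ℝ) * (mse P D T θ₀ n - (θ - θ₀) ^ 2)) atTop (𝓝 0) := by
  have hinv : Tendsto (fun n : ℕ => (√(n : ℝ))⁻¹) atTop (𝓝 0) :=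
    tendsto_inv_atTop_zero.comp (Real.tendsto_sqrt_atTop.comp tendsto_natCast_atTop_atTop)
  have hlim := ((hinv.mul (hT.tendsto_mul_integral_sq hD))).add
    ((hT.tendsto_sqrt_mul_integral hD).const_mul (2 * (θ - θ₀)))
  rw [zero_mul, mul_zero, add_zero] at hlim
  refine hlim.congr' ?_
  filter_upwards [hT.eventually_memLp hD] with n hn
  have hsq : ∀ ω, (onFull D T n ω - θ₀) ^ 2
      = (onFull D T n ω - θ) ^ 2 + 2 * (θ - θ₀) * (onFull D T n ω - θ) + (θ - θ₀) ^ 2 :=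
    fun ω => by ring
  have hi : Integrable (fun ω => onFull D T n ω - θ) P := hn.integrable one_le_two
  simp_rw [mse, hsq]
  rw [integral_add_add hn.integrable_sq (hi.const_mul _) (integrable_const _),
    integral_const_mul, integral_const,
    probReal_univ, one_smul, ← mul_assoc, inv_mul_eq_div, Real.div_sqrt]
  ring

end ModelSelection

end

/-! ### Variance comparison for the Gaussian limits. -/

noncomputable section

theorem ProbabilityTheory.HasGaussianLaw.memLp_sq {Ω : Type*} [MeasurableSpace Ω] {P : Measure Ω}
    {X : Ω → ℝ} (hX : HasGaussianLaw X P) : MemLp (fun ω => X ω ^ 2) 2 P := by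
  have hm : AEStronglyMeasurable (fun ω => X ω ^ 2) P :=
    (hX.aemeasurable.pow_const 2).aestronglyMeasurable
  refine (memLp_two_iff_integrable_sq hm).2 ?_
  have h := (hX.memLp (p := ((4 : ℕ) : ENNReal)) (by simp)).integrable_norm_pow (by norm_num)
  refine h.congr (Eventually.of_forall fun ω => ?_)
  simp only [Real.norm_eq_abs]
  rw [← sq_abs (X ω), ← pow_mul]

theorem ProbabilityTheory.HasGaussianLaw.measure_lt_sq_pos {Ω : Type*} [MeasurableSpace Ω]
    {P : Measure Ω} {X : Ω → ℝ} (hX : HasGaussianLaw X P) (hvar : 0 < Var[X; P]) (c : ℝ) :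
    0 < P {ω | c < X ω ^ 2} := by
  have hne : Var[X; P].toNNReal ≠ 0 := (Real.toNNReal_pos.2 hvar).ne'
  have hopen : IsOpen {y : ℝ | c < y ^ 2} := isOpen_lt continuous_const (by fun_prop)
  have hnonempty : {y : ℝ | c < y ^ 2}.Nonempty :=
    ⟨|c| + 1, by
      simp only [Set.mem_ofPred_eq]
      nlinarith [abs_nonneg c, le_abs_self c]⟩
  have hpos : 0 < (gaussianReal P[X] Var[X; P].toNNReal) {y : ℝ | c < y ^ 2} := by
    refine pos_iff_ne_zero.2 fun h0 => ?_
    exact (hopen.measure_pos volume hnonempty).ne' (gaussianReal_absolutelyContinuous' _ hne h0)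
  rw [← hX.map_eq_gaussianReal, Measure.map_apply_of_aemeasurable hX.aemeasurable
    hopen.measurableSet] at hpos
  exact hpos

namespace ModelSelection

variable {Ω 𝒳 : Type*} {K : ℕ}

/-- The vector representing `fullForm`. -/
def fullVec (K : ℕ) : EuclideanSpace ℝ (Fin K × Fin 2) :=
  WithLp.toLp 2 fun p => ![1, -1] p.2

/-- The vector representing the deviation of `cvForm · k` from `fullForm`. -/
def devVec (k : Fin K) : EuclideanSpace ℝ (Fin K × Fin 2) :=
  WithLp.toLp 2 fun p => (if p.1 = k then 1 - (K : ℝ) else 1) * ![((K : ℝ) - 1)⁻¹, 1] p.2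

theorem inner_fullVec (x : EuclideanSpace ℝ (Fin K × Fin 2)) :
    inner ℝ (fullVec K) x = fullForm x := by
  rw [PiLp.inner_apply, Fintype.sum_prod_type, fullForm]
  refine Finset.sum_congr rfl fun k _ => ?_
  simp [fullVec, Fin.sum_univ_two]
  ring

theorem inner_devVec (hK : 2 ≤ K) (k : Fin K) (x : EuclideanSpace ℝ (Fin K × Fin 2)) :
    inner ℝ (devVec k) x = cvForm x k - fullForm x := by
  have hK1 : (K : ℝ) - 1 ≠ 0 := by
    have : (2 : ℝ) ≤ K := by exact_mod_cast hK
    linarith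
  have h : inner ℝ (devVec k) x
      = ∑ j, (if j = k then 1 - (K : ℝ) else 1) * (((K : ℝ) - 1)⁻¹ * x (j, 0) + x (j, 1)) := by
    rw [PiLp.inner_apply, Fintype.sum_prod_type]
    refine Finset.sum_congr rfl fun j _ => ?_
    simp only [devVec, RCLike.inner_apply, conj_trivial, Fin.sum_univ_two, Matrix.cons_val_zero,
      Matrix.cons_val_one]
    ring
  rw [h, cvForm, fullForm, ← Finset.sum_compl_add_sum {k}, ← Finset.sum_compl_add_sum {k}
    fun j => x (j, 0) - x (j, 1), Finset.sum_singleton, Finset.sum_singleton,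
    Finset.sum_congr rfl (g := fun j => ((K : ℝ) - 1)⁻¹ * x (j, 0) + x (j, 1)) fun j hj => by
      rw [if_neg (by simpa using hj), one_mul], if_pos rfl, Finset.sum_add_distrib,
    Finset.sum_sub_distrib, ← Finset.mul_sum]
  field_simp
  ring

/-- The mean of squares is the squared mean plus the spread around it, the mean being `fullForm x`.
-/
theorem sum_sq_cvForm (hK : 2 ≤ K) (x : EuclideanSpace ℝ (Fin K × Fin 2)) :
    1 / (K : ℝ) * ∑ k, cvForm x k ^ 2
      = fullForm x ^ 2 + 1 / (K : ℝ) * ∑ k, (cvForm x k - fullForm x) ^ 2 := by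
  have hK0 : (K : ℝ) ≠ 0 := by positivity
  have h : ∀ k, (cvForm x k - fullForm x) ^ 2
      = cvForm x k ^ 2 - 2 * fullForm x * cvForm x k + fullForm x ^ 2 := fun k => by ring
  simp_rw [h]
  rw [Finset.sum_add_distrib, Finset.sum_sub_distrib, ← Finset.mul_sum, sum_cvForm hK]
  simp only [Finset.sum_const, Finset.card_univ, Fintype.card_fin, nsmul_eq_mul]
  field_simp
  ring

theorem sum_devVec_coeff (k : Fin K) :
    ∑ j : Fin K, (if j = k then 1 - (K : ℝ) else 1) = 0 := by
  rw [← Finset.sum_compl_add_sum {k}, Finset.sum_singleton, if_pos rfl,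
    Finset.sum_congr rfl (g := fun _ => (1 : ℝ)) fun j hj => if_neg (by simpa using hj)]
  have : 1 ≤ K := k.pos
  simp [Finset.card_compl, Nat.cast_sub this]

variable [MeasurableSpace Ω] {P : Measure Ω} {D : ℕ → Ω → 𝒳} {f : Fin 2 → 𝒳 → ℝ}

theorem covariance_inner_foldCov (hL2 : ∀ a, MemLp (fun ω => f a (D 0 ω)) 2 P)
    (x y : EuclideanSpace ℝ (Fin K × Fin 2)) :
    cov[fun z => inner ℝ x z, fun z => inner ℝ y z; multivariateGaussian 0 (foldCov P D f K)]
      = ∑ k, 1 / (K : ℝ) *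
        ∫ ω, (∑ a, x (k, a) * f a (D 0 ω)) * (∑ a, y (k, a) * f a (D 0 ω)) ∂P := by
  rw [← covarianceBilin_apply_eq_cov IsGaussian.memLp_two_id,
    covarianceBilin_multivariateGaussian (posSemidef_foldCov hL2), dotProduct_foldCov_mulVec hL2]

/-- Fold `j` contributes a common integral times the fold coefficient of `devVec k`; these
coefficients are `1` for the `K - 1` other folds and `1 - K` for fold `k`, so they cancel. -/
theorem covariance_fullVec_devVec (hL2 : ∀ a, MemLp (fun ω => f a (D 0 ω)) 2 P) (k : Fin K) :
    cov[fun z => inner ℝ (fullVec K) z, fun z => inner ℝ (devVec k) z;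
      multivariateGaussian 0 (foldCov P D f K)] = 0 := by
  rw [covariance_inner_foldCov hL2]
  have h : ∀ j : Fin K, 1 / (K : ℝ) * ∫ ω, (∑ a, fullVec K (j, a) * f a (D 0 ω)) *
      (∑ a, devVec k (j, a) * f a (D 0 ω)) ∂P
      = (if j = k then 1 - (K : ℝ) else 1) * (1 / (K : ℝ) *
        ∫ ω, (f 0 (D 0 ω) - f 1 (D 0 ω)) * (((K : ℝ) - 1)⁻¹ * f 0 (D 0 ω) + f 1 (D 0 ω)) ∂P) := by
    intro j
    rw [mul_left_comm]
    congr 1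
    rw [← integral_const_mul]
    refine integral_congr_ae (Eventually.of_forall fun ω => ?_)
    simp only [fullVec, devVec, Fin.sum_univ_two, Matrix.cons_val_zero, Matrix.cons_val_one]
    ring
  simp_rw [h]
  rw [← Finset.sum_mul, sum_devVec_coeff, zero_mul]

theorem variance_devVec_pos (hK : 2 ≤ K) (hL2 : ∀ a, MemLp (fun ω => f a (D 0 ω)) 2 P)
    (hpos : 0 < ∫ ω, (((K : ℝ) - 1)⁻¹ * f 0 (D 0 ω) + f 1 (D 0 ω)) ^ 2 ∂P) (k : Fin K) :
    0 < Var[fun z => inner ℝ (devVec k) z; multivariateGaussian 0 (foldCov P D f K)] := by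
  have hK2 : (2 : ℝ) ≤ K := by exact_mod_cast hK
  rw [← covariance_self (by fun_prop), covariance_inner_foldCov hL2]
  have h : ∀ j : Fin K, 1 / (K : ℝ) * ∫ ω, (∑ a, devVec k (j, a) * f a (D 0 ω)) *
      (∑ a, devVec k (j, a) * f a (D 0 ω)) ∂P
      = 1 / (K : ℝ) * ((if j = k then 1 - (K : ℝ) else 1) ^ 2 *
        ∫ ω, (((K : ℝ) - 1)⁻¹ * f 0 (D 0 ω) + f 1 (D 0 ω)) ^ 2 ∂P) := by
    intro j
    congr 1
    rw [← integral_const_mul]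
    refine integral_congr_ae (Eventually.of_forall fun ω => ?_)
    simp only [devVec, Fin.sum_univ_two, Matrix.cons_val_zero, Matrix.cons_val_one]
    ring
  simp_rw [h]
  refine Finset.sum_pos (fun j _ => ?_) ⟨k, Finset.mem_univ k⟩
  have hc : (if j = k then 1 - (K : ℝ) else 1) ≠ 0 := by
    split_ifs
    · linarith
    · exact one_ne_zero
  positivity

theorem hasGaussianLaw_inner (S : Matrix (Fin K × Fin 2) (Fin K × Fin 2) ℝ)
    (x : EuclideanSpace ℝ (Fin K × Fin 2)) :
    HasGaussianLaw (fun z => inner ℝ x z) (multivariateGaussian 0 S) :=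
  IsGaussian.hasGaussianLaw_id.map_fun (innerSL ℝ x)

theorem hasGaussianLaw_fullForm (S : Matrix (Fin K × Fin 2) (Fin K × Fin 2) ℝ) :
    HasGaussianLaw fullForm (multivariateGaussian 0 S) := by
  simpa only [inner_fullVec] using hasGaussianLaw_inner S (fullVec K)

theorem memLp_sum_sq_dev (hK : 2 ≤ K) (S : Matrix (Fin K × Fin 2) (Fin K × Fin 2) ℝ) :
    MemLp (fun x => 1 / (K : ℝ) * ∑ k, (cvForm x k - fullForm x) ^ 2) 2
      (multivariateGaussian 0 S) := by
  simp_rw [← inner_devVec hK]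
  exact (memLp_finsetSum _ fun k _ => (hasGaussianLaw_inner S (devVec k)).memLp_sq).const_mul _

theorem memLp_sum_sq_cvForm (hK : 2 ≤ K) (S : Matrix (Fin K × Fin 2) (Fin K × Fin 2) ℝ) :
    MemLp (fun x => 1 / (K : ℝ) * ∑ k, cvForm x k ^ 2) 2 (multivariateGaussian 0 S) := by
  simp_rw [sum_sq_cvForm hK]
  exact (hasGaussianLaw_fullForm S).memLp_sq.add (memLp_sum_sq_dev hK S)

theorem indepFun_fullForm_dev (hK : 2 ≤ K) (hL2 : ∀ a, MemLp (fun ω => f a (D 0 ω)) 2 P) :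
    IndepFun (fun (x : EuclideanSpace ℝ (Fin K × Fin 2)) (_ : Unit) => fullForm x)
      (fun x k => cvForm x k - fullForm x) (multivariateGaussian 0 (foldCov P D f K)) := by
  simp_rw [← inner_devVec hK, ← inner_fullVec]
  refine HasGaussianLaw.indepFun_of_covariance_eval
    (X := fun (_ : Unit) x => inner ℝ (fullVec K) x) (Y := fun k x => inner ℝ (devVec k) x) ?_
    fun _ k => covariance_fullVec_devVec hL2 k
  exact IsGaussian.hasGaussianLaw_id.map_fun
    ((ContinuousLinearMap.pi fun _ : Unit => innerSL ℝ (fullVec K)).prod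
      (ContinuousLinearMap.pi fun k => innerSL ℝ (devVec k)))

theorem variance_sum_sq_dev_pos (hK : 2 ≤ K) (hL2 : ∀ a, MemLp (fun ω => f a (D 0 ω)) 2 P)
    (hpos : 0 < ∫ ω, (((K : ℝ) - 1)⁻¹ * f 0 (D 0 ω) + f 1 (D 0 ω)) ^ 2 ∂P) :
    0 < Var[fun x => 1 / (K : ℝ) * ∑ k, (cvForm x k - fullForm x) ^ 2;
      multivariateGaussian 0 (foldCov P D f K)] := by
  set ν := multivariateGaussian 0 (foldCov P D f K)
  refine lt_of_le_of_ne (variance_nonneg _ _) fun h0 => ?_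
  have hae := ae_eq_integral_of_variance_eq_zero (memLp_sum_sq_dev hK (foldCov P D f K)) h0.symm
  set c := ∫ x, 1 / (K : ℝ) * ∑ k, (cvForm x k - fullForm x) ^ 2 ∂ν with hc
  have hK0 : (0 : ℝ) < K := by positivity
  -- Zero variance would make the average constant, equal to `c`; but a single nondegenerate
  -- Gaussian square exceeds `K * c` with positive probability.
  let k₀ : Fin K := ⟨0, by omega⟩
  have hlt := (hasGaussianLaw_inner (foldCov P D f K) (devVec k₀)).measure_lt_sq_pos
    (variance_devVec_pos hK hL2 hpos k₀) (K * c)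
  refine hlt.ne' (measure_mono_null ?_ (ae_iff.1 hae))
  intro x hx
  simp only [Set.mem_ofPred_eq, inner_devVec hK] at hx ⊢
  refine ne_of_gt (lt_of_lt_of_le ?_ (mul_le_mul_of_nonneg_left
    (Finset.single_le_sum (f := fun k => (cvForm x k - fullForm x) ^ 2)
      (fun k _ => sq_nonneg _) (Finset.mem_univ k₀)) (by positivity)))
  rw [one_div, inv_mul_eq_div, lt_div_iff₀ hK0, mul_comm]
  exact hx

theorem variance_fullForm_sq_lt (hK : 2 ≤ K) (hL2 : ∀ a, MemLp (fun ω => f a (D 0 ω)) 2 P)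
    (hpos : 0 < ∫ ω, (((K : ℝ) - 1)⁻¹ * f 0 (D 0 ω) + f 1 (D 0 ω)) ^ 2 ∂P) :
    Var[fun x => fullForm x ^ 2; multivariateGaussian 0 (foldCov P D f K)]
      < Var[fun x => 1 / (K : ℝ) * ∑ k, cvForm x k ^ 2;
        multivariateGaussian 0 (foldCov P D f K)] := by
  have hind := (indepFun_fullForm_dev hK hL2).comp (φ := fun u : Unit → ℝ => u () ^ 2)
    (ψ := fun v : Fin K → ℝ => 1 / (K : ℝ) * ∑ k, v k ^ 2) (by fun_prop) (by fun_prop)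
  simp_rw [sum_sq_cvForm hK]
  have h := IndepFun.variance_fun_add (hasGaussianLaw_fullForm (foldCov P D f K)).memLp_sq
    (memLp_sum_sq_dev hK (foldCov P D f K)) hind
  rw [h]
  exact lt_add_of_pos_right _ (variance_sum_sq_dev_pos hK hL2 hpos)

end ModelSelection

end

/-! ### Asymptotic variances of the two criteria. -/

noncomputable section

namespace ModelSelection

variable {Ω 𝒳 : Type*} [MeasurableSpace Ω] {P : Measure Ω}

/-- Otherwise `Y = -c X` almost surely, and the correlation would be `-1`. -/
theorem integral_sq_smul_add_pos {X Y : Ω → ℝ} (hX : MemLp X 2 P) (hY : MemLp Y 2 P)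
    (hX0 : ∫ ω, X ω ∂P = 0) (hXne : ∫ ω, X ω ^ 2 ∂P ≠ 0)
    (hcor : |correlation P X Y| ≠ 1) {c : ℝ} (hc : 0 < c) :
    0 < ∫ ω, (c * X ω + Y ω) ^ 2 ∂P := by
  refine lt_of_le_of_ne (integral_nonneg fun ω => sq_nonneg _) fun h0 => hcor ?_
  have hae : (fun ω => (c * X ω + Y ω) ^ 2) =ᵐ[P] 0 :=
    (integral_eq_zero_iff_of_nonneg (fun ω => sq_nonneg _)
      ((hX.const_mul c).add hY).integrable_sq).1 h0.symm
  have hYX : Y =ᵐ[P] fun ω => -c * X ω := by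
    filter_upwards [hae] with ω hω
    have := pow_eq_zero_iff two_ne_zero |>.1 hω
    linarith
  have hvpos : 0 < Var[X; P] := by
    rw [variance_of_integral_eq_zero hX.aestronglyMeasurable.aemeasurable hX0]
    exact lt_of_le_of_ne (integral_nonneg fun ω => sq_nonneg _) (Ne.symm hXne)
  have hcov : cov[X, Y; P] = -c * Var[X; P] := by
    have h : cov[X, Y; P] = cov[X, fun ω => -c * X ω; P] := by
      rw [covariance, covariance, integral_congr_ae hYX]
      refine integral_congr_ae ?_
      filter_upwards [hYX] with ω hω
      rw [hω]
    rw [h, covariance_const_mul_right, covariance_self hX.aestronglyMeasurable.aemeasurable]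
  have hvar : Var[Y; P] = c ^ 2 * Var[X; P] := by
    rw [variance_congr hYX, variance_const_mul, neg_sq]
  have hs : √(Var[X; P]) * √(Var[X; P]) = Var[X; P] := Real.mul_self_sqrt hvpos.le
  rw [correlation, hcov, hvar, Real.sqrt_mul (sq_nonneg c), Real.sqrt_sq hc.le, mul_left_comm, hs,
    neg_mul, neg_div, div_self (by positivity), abs_neg, abs_one]

theorem hasAsympVariance_of_tendstoInDistribution [IsProbabilityMeasure P]
    {E : Type*} [MeasurableSpace E] {ν : Measure E}
    [IsProbabilityMeasure ν] {X : ℕ → Ω → ℝ} {Z : E → ℝ} (hZ : MemLp Z 2 ν)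
    (h : TendstoInDistribution X atTop Z (fun _ => P) ν) :
    HasAsympVariance P X Var[Z; ν] := by
  have hZm := hZ.aestronglyMeasurable.aemeasurable
  have hprob := Measure.isProbabilityMeasure_map (μ := ν) hZm
  have hlim : TendstoInDistribution X atTop (fun x : ℝ => x) (fun _ => P) (ν.map Z) := by
    refine ⟨h.forall_aemeasurable, aemeasurable_id', ?_⟩
    convert! h.tendsto using 3
    exact congrArg 𝓝 (Subtype.ext Measure.map_id')
  refine ⟨⟨ν.map Z, hprob⟩, ?_, ?_, hlim⟩
  · exact (memLp_map_measure_iff aestronglyMeasurable_id hZm).2 hZ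
  · exact variance_id_map hZm

/-- By Slutsky the second summand only translates the limit law, so terms with constant limits do
not affect the asymptotic variance. -/
theorem hasAsympVariance_add [IsProbabilityMeasure P]
    {E : Type*} [MeasurableSpace E] {ν : Measure E}
    [IsProbabilityMeasure ν] {X Y : ℕ → Ω → ℝ} {Z : E → ℝ} (hZ : MemLp Z 2 ν)
    (h : TendstoInDistribution X atTop Z (fun _ => P) ν) {c : ℝ}
    (hY : TendstoInMeasure P Y atTop fun _ => c) (hYm : ∀ n, AEMeasurable (Y n) P) :
    HasAsympVariance P (fun n ω => X n ω + Y n ω) Var[Z; ν] := by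
  rw [← variance_add_const hZ.aestronglyMeasurable c]
  exact hasAsympVariance_of_tendstoInDistribution (hZ.add (memLp_const c))
    (h.add_of_tendstoInMeasure_const hY hYm)

theorem tendsto_inv_sqrt_natCast : Tendsto (fun n : ℕ => (√(n : ℝ))⁻¹) atTop (𝓝 0) :=
  tendsto_inv_atTop_zero.comp (Real.tendsto_sqrt_atTop.comp tendsto_natCast_atTop_atTop)

theorem IsConsistentVariance.exists_tendstoInMeasure {V X : ℕ → Ω → ℝ}
    (h : IsConsistentVariance P V X) :
    ∃ v : ℝ, TendstoInMeasure P (fun (n : ℕ) ω => (n : ℝ) * V n ω) atTop fun _ => v := by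
  obtain ⟨-, v, -, hv⟩ := h
  refine ⟨v, ?_⟩
  have := hv.add_const_lim (tendstoInMeasure_const_of_tendsto (tendsto_const_nhds (x := v)))
  simpa using this

theorem IsConsistentVariance.tendstoInMeasure_sqrt_mul {V X : ℕ → Ω → ℝ}
    (h : IsConsistentVariance P V X) :
    TendstoInMeasure P (fun (n : ℕ) ω => √(n : ℝ) * V n ω) atTop fun _ => 0 := by
  obtain ⟨v, hv⟩ := h.exists_tendstoInMeasure
  have := (tendstoInMeasure_const_of_tendsto (μ := P) tendsto_inv_sqrt_natCast).mul_const_lim hv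
  simp_rw [← mul_assoc, inv_mul_eq_div, Real.div_sqrt, zero_mul] at this
  exact this

section

variable [MeasurableSpace 𝒳] {D : ℕ → Ω → 𝒳} {K : ℕ} {A : (n : ℕ) → Ω → Fin n → Fin K}
  {T T₀ : Estimator 𝒳} {θ θ₀ : ℝ} {ψ ψ₀ : 𝒳 → ℝ}

theorem mul_self_sqrt_natCast (n : ℕ) : √(n : ℝ) * √(n : ℝ) = n :=
  Real.mul_self_sqrt (Nat.cast_nonneg n)

theorem sqrt_mul_sqrt_mul_inv (n : ℕ) : √(n : ℝ) * √(n : ℝ) * (√(n : ℝ))⁻¹ = √(n : ℝ) := by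
  rw [mul_self_sqrt_natCast, ← div_eq_mul_inv, Real.div_sqrt]

/-- The second-order expansion of a squared difference around its limit. -/
theorem sqrt_mul_sq_sub_sq (n : ℕ) (x δ : ℝ) :
    √(n : ℝ) * (x ^ 2 - δ ^ 2) = 2 * δ * (√(n : ℝ) * (x - δ))
      + (√(n : ℝ) * (x - δ)) ^ 2 * (√(n : ℝ))⁻¹ := by
  have h : (√(n : ℝ) * (x - δ)) ^ 2 * (√(n : ℝ))⁻¹
      = √(n : ℝ) * √(n : ℝ) * (√(n : ℝ))⁻¹ * (x - δ) ^ 2 := by ring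
  rw [h, sqrt_mul_sqrt_mul_inv]
  ring

theorem riskHat_hasAsympVariance_of_eq [IsProbabilityMeasure P]
    {ν : Measure (EuclideanSpace ℝ (Fin K × Fin 2))} [IsProbabilityMeasure ν]
    (hD : IsIID P D) (hT : IsAsympLinear P D T θ₀ ψ) {Vdiff V X X' : ℕ → Ω → ℝ}
    (hVdiff : IsConsistentVariance P Vdiff X) (hV : IsConsistentVariance P V X')
    (hU : TendstoInDistribution (fun n ω => fullError D T T₀ 0 n ω) atTop fullForm
      (fun _ => P) ν) (hL2 : MemLp (fun x => fullForm x ^ 2) 2 ν) :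
    HasAsympVariance P (fun n ω => (n : ℝ) * (riskHat D T T₀ Vdiff V n ω - mse P D T θ₀ n))
      Var[fun x => fullForm x ^ 2; ν] := by
  obtain ⟨v, hv⟩ := hVdiff.exists_tendstoInMeasure
  obtain ⟨v', hv'⟩ := hV.exists_tendstoInMeasure
  -- The scaled variance estimators and the scaled risk all tend to constants; the values of these
  -- are irrelevant here.
  have hY := (((tendstoInMeasure_const_of_tendsto (μ := P)
    (tendsto_const_nhds (x := (-1 : ℝ)))).mul_const_lim hv).add_const_lim hv').add_const_lim
    (tendstoInMeasure_const_of_tendsto (μ := P) (hT.tendsto_mul_mse hD).neg)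
  have h := hasAsympVariance_add hL2 (hU.continuous_comp (g := fun u : ℝ => u ^ 2) (by fun_prop))
    hY fun n => by
      have h1 := hVdiff.1 n
      have h2 := hV.1 n
      fun_prop
  convert! h using 3 with n ω
  simp only [Function.comp_apply, fullError, riskHat, sub_zero, mul_pow,
    Real.sq_sqrt (Nat.cast_nonneg n)]
  ring

theorem riskCV_hasAsympVariance_of_eq [IsProbabilityMeasure P]
    {ν : Measure (EuclideanSpace ℝ (Fin K × Fin 2))} [IsProbabilityMeasure ν]
    (hD : IsIID P D) (hT : IsAsympLinear P D T θ₀ ψ)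
    (hW : TendstoInDistribution (fun n ω => cvError D T T₀ 0 (A n ω) ω) atTop cvForm
      (fun _ => P) ν) (hL2 : MemLp (fun x => 1 / (K : ℝ) * ∑ k, cvForm x k ^ 2) 2 ν) :
    HasAsympVariance P (fun n ω => (n : ℝ) * (riskCV D T T₀ A n ω - mse P D T θ₀ n))
      Var[fun x => 1 / (K : ℝ) * ∑ k, cvForm x k ^ 2; ν] := by
  have h := hasAsympVariance_add hL2 (hW.continuous_comp
    (g := fun w : Fin K → ℝ => 1 / (K : ℝ) * ∑ k, w k ^ 2) (by fun_prop))
    (tendstoInMeasure_const_of_tendsto (μ := P) (hT.tendsto_mul_mse hD).neg)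
    fun n => aemeasurable_const
  convert! h using 3 with n ω
  simp only [Function.comp_apply, cvError, riskCV, sub_zero, mul_pow,
    Real.sq_sqrt (Nat.cast_nonneg n), ← Finset.mul_sum]
  ring

theorem riskHat_hasAsympVariance [IsProbabilityMeasure P]
    {ν : Measure (EuclideanSpace ℝ (Fin K × Fin 2))} [IsProbabilityMeasure ν]
    (hD : IsIID P D) (hT : IsAsympLinear P D T θ ψ) {Vdiff V X X' : ℕ → Ω → ℝ}
    (hVdiff : IsConsistentVariance P Vdiff X) (hV : IsConsistentVariance P V X')
    (hU : TendstoInDistribution (fun n ω => fullError D T T₀ (θ - θ₀) n ω) atTop fullForm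
      (fun _ => P) ν) (hL2 : MemLp fullForm 2 ν) :
    HasAsympVariance P (fun n ω => √(n : ℝ) * (riskHat D T T₀ Vdiff V n ω - mse P D T θ₀ n))
      Var[fun x => 2 * (θ - θ₀) * fullForm x; ν] := by
  have hY := (((tendstoInMeasure_const_of_tendsto (μ := P)
    (tendsto_const_nhds (x := (-1 : ℝ)))).mul_const_lim
    hVdiff.tendstoInMeasure_sqrt_mul).add_const_lim hV.tendstoInMeasure_sqrt_mul).add_const_lim
    (tendstoInMeasure_const_of_tendsto (μ := P) (hT.tendsto_sqrt_mul_mse_sub hD θ₀).neg)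
  have hX := hU.continuous_comp_prodMk_of_tendstoInMeasure_const
    (g := fun p : ℝ × ℝ => 2 * (θ - θ₀) * p.1 + p.1 ^ 2 * p.2) (by fun_prop)
    (tendstoInMeasure_const_of_tendsto (μ := P) tendsto_inv_sqrt_natCast)
    fun n => aemeasurable_const
  simp only [mul_zero, add_zero] at hX
  have h := hasAsympVariance_add (hL2.const_mul (2 * (θ - θ₀))) hX hY fun n => by
    have h1 := hVdiff.1 n
    have h2 := hV.1 n
    fun_prop
  convert! h using 3 with n ω
  simp only [fullError]
  rw [← sqrt_mul_sq_sub_sq, riskHat]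
  ring

theorem riskCV_hasAsympVariance [IsProbabilityMeasure P] (hK : 2 ≤ K)
    {ν : Measure (EuclideanSpace ℝ (Fin K × Fin 2))} [IsProbabilityMeasure ν]
    (hD : IsIID P D) (hT : IsAsympLinear P D T θ ψ)
    (hW : TendstoInDistribution (fun n ω => cvError D T T₀ (θ - θ₀) (A n ω) ω) atTop cvForm
      (fun _ => P) ν) (hL2 : MemLp fullForm 2 ν) :
    HasAsympVariance P (fun n ω => √(n : ℝ) * (riskCV D T T₀ A n ω - mse P D T θ₀ n))
      Var[fun x => 2 * (θ - θ₀) * fullForm x; ν] := by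
  have hK0 : (K : ℝ) ≠ 0 := by positivity
  have hX := hW.continuous_comp_prodMk_of_tendstoInMeasure_const
    (g := fun p : (Fin K → ℝ) × ℝ =>
      1 / (K : ℝ) * ∑ k, (2 * (θ - θ₀) * p.1 k + p.1 k ^ 2 * p.2)) (by fun_prop)
    (tendstoInMeasure_const_of_tendsto (μ := P) tendsto_inv_sqrt_natCast)
    fun n => aemeasurable_const
  -- In the limit the quadratic terms carry the factor `0`, and the linear terms average to
  -- `fullForm`: this is why both criteria share one limit.
  have hZ : ∀ x : EuclideanSpace ℝ (Fin K × Fin 2),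
      1 / (K : ℝ) * ∑ k, (2 * (θ - θ₀) * cvForm x k + cvForm x k ^ 2 * 0)
        = 2 * (θ - θ₀) * fullForm x := fun x => by
    simp only [mul_zero, add_zero]
    rw [← Finset.mul_sum, sum_cvForm hK]
    field_simp
  simp only [hZ] at hX
  have h := hasAsympVariance_add (hL2.const_mul (2 * (θ - θ₀))) hX
    (tendstoInMeasure_const_of_tendsto (μ := P) (hT.tendsto_sqrt_mul_mse_sub hD θ₀).neg)
    fun n => aemeasurable_const
  convert! h using 3 with n ω
  simp only [cvError]
  simp_rw [← sqrt_mul_sq_sub_sq]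
  rw [← Finset.mul_sum, Finset.sum_sub_distrib, riskCV]
  simp only [Finset.sum_const, Finset.card_univ, Fintype.card_fin, nsmul_eq_mul]
  field_simp
  ring

end

end ModelSelection

end

theorem theorem3 {Ω 𝒳 : Type*} [MeasurableSpace Ω] [MeasurableSpace 𝒳]
    (P : Measure Ω) [IsProbabilityMeasure P]
    (D : ℕ → Ω → 𝒳) (hD : ModelSelection.IsIID P D)
    (G : ℕ) (T : Fin (G + 1) → ModelSelection.Estimator 𝒳)
    (θ : Fin (G + 1) → ℝ) (ψ : Fin (G + 1) → 𝒳 → ℝ)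
    (hT : ∀ g, ModelSelection.IsAsympLinear P D (T g) (θ g) (ψ g))
    (hcor : ∀ g, g ≠ 0 →
      |ModelSelection.correlation P (fun ω => ψ g (D 0 ω)) (fun ω => ψ 0 (D 0 ω))| ≠ 1)
    (Vdiff V : Fin (G + 1) → ℕ → Ω → ℝ)
    (hVdiff : ∀ g, ModelSelection.IsConsistentVariance P (Vdiff g)
      (fun n ω => ModelSelection.onFull D (T g) n ω - ModelSelection.onFull D (T 0) n ω))
    (hV : ∀ g, ModelSelection.IsConsistentVariance P (V g) (ModelSelection.onFull D (T g)))
    (K : ℕ) (hK : 2 ≤ K)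
    (A : (n : ℕ) → Ω → Fin n → Fin K) (hA : ModelSelection.IsRandomSplit P D A)
    (g : Fin (G + 1)) :
    (θ g = θ 0 → ∃ vHat vCV : ℝ,
      ModelSelection.HasAsympVariance P
        (fun n ω => (n : ℝ) * (ModelSelection.riskHat D (T g) (T 0) (Vdiff g) (V g) n ω
          - ModelSelection.mse P D (T g) (θ 0) n)) vHat ∧
      ModelSelection.HasAsympVariance P
        (fun n ω => (n : ℝ) * (ModelSelection.riskCV D (T g) (T 0) A n ω
          - ModelSelection.mse P D (T g) (θ 0) n)) vCV ∧
      vHat < vCV) ∧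
    (θ g ≠ θ 0 → ∃ v : ℝ,
      ModelSelection.HasAsympVariance P
        (fun n ω => √(n : ℝ) * (ModelSelection.riskHat D (T g) (T 0) (Vdiff g) (V g) n ω
          - ModelSelection.mse P D (T g) (θ 0) n)) v ∧
      ModelSelection.HasAsympVariance P
        (fun n ω => √(n : ℝ) * (ModelSelection.riskCV D (T g) (T 0) A n ω
          - ModelSelection.mse P D (T g) (θ 0) n)) v) 
    := by
  have hfm : ∀ a, Measurable ((![ψ g, ψ 0] : Fin 2 → 𝒳 → ℝ) a) :=
    Fin.forall_fin_two.2 ⟨(hT g).measurable_influence, (hT 0).measurable_influence⟩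
  have hfL2 : ∀ a, MemLp (fun ω => (![ψ g, ψ 0] : Fin 2 → 𝒳 → ℝ) a (D 0 ω)) 2 P :=
    Fin.forall_fin_two.2 ⟨(hT g).memLp, (hT 0).memLp⟩
  have hfc : ∀ a, ∫ ω, (![ψ g, ψ 0] : Fin 2 → 𝒳 → ℝ) a (D 0 ω) ∂P = 0 :=
    Fin.forall_fin_two.2 ⟨(hT g).centered, (hT 0).centered⟩
  have hS := hA.tendstoInDistribution_foldScore hD hfm hfL2 hfc
  have hU := ModelSelection.tendstoInDistribution_fullError hD (hT g) (hT 0) hS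
  have hW := hA.tendstoInDistribution_cvError hK hD (hT g) (hT 0) hS
  have hG := ModelSelection.hasGaussianLaw_fullForm
    (ModelSelection.foldCov P D ![ψ g, ψ 0] K)
  refine ⟨fun hθ => ?_, fun _ => ?_⟩
  · rw [hθ, sub_self] at hU hW
    have hTg := hT g
    rw [hθ] at hTg
    refine ⟨_, _, ModelSelection.riskHat_hasAsympVariance_of_eq hD hTg (hVdiff g) (hV g) hU
      hG.memLp_sq, ModelSelection.riskCV_hasAsympVariance_of_eq hD hTg hW
      (ModelSelection.memLp_sum_sq_cvForm hK _),
      ModelSelection.variance_fullForm_sq_lt hK hfL2 ?_⟩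
    have hc : 0 < ((K : ℝ) - 1)⁻¹ := by
      have : (2 : ℝ) ≤ K := by exact_mod_cast hK
      exact inv_pos.2 (by linarith)
    -- For `g = 0` the two influence functions coincide and have correlation `1`; the sum is then a
    -- positive multiple of `ψ 0`, which is nondegenerate.
    rcases eq_or_ne g 0 with rfl | hg
    · have h : ∀ ω, (((K : ℝ) - 1)⁻¹ * ψ 0 (D 0 ω) + ψ 0 (D 0 ω)) ^ 2
          = (((K : ℝ) - 1)⁻¹ + 1) ^ 2 * ψ 0 (D 0 ω) ^ 2 := fun ω => by ring
      simp only [Matrix.cons_val_zero, Matrix.cons_val_one, h, integral_const_mul]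
      exact mul_pos (by positivity) (lt_of_le_of_ne (integral_nonneg fun ω => sq_nonneg _)
        (hT 0).nonzero.symm)
    · exact ModelSelection.integral_sq_smul_add_pos (hT g).memLp (hT 0).memLp (hT g).centered
        (hT g).nonzero (hcor g hg) hc
  · exact ⟨_, ModelSelection.riskHat_hasAsympVariance hD (hT g) (hVdiff g) (hV g) hU hG.memLp_two,
      ModelSelection.riskCV_hasAsympVariance hK hD (hT g) hW hG.memLp_two⟩
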